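/- Let $d\ge 1$. A free minimal Cantor system $(X,\varphi,\mathbb{Z}^d)$ is an action $\varphi$ of $\mathbb{Z}^d$ by homeomorphisms $\varphi^v$ on a Cantor set $X$ such that $\varphi^v(x)=x$ only for $v=0$, and every orbit is dense. A bounded orbit injection from $(X,\varphi,\mathbb{Z}^d)$ to $(Z,\alpha,\mathbb{Z}^d)$ is a continuous open injection $\theta:X\to Z$ such that $x,y\in X$ lie in the same $\varphi$-orbit if and only if $\theta(x),\theta(y)$ lie in the same $\alpha$-orbit, and such that the cocycle $\eta:X\times\mathbb{Z}^d\to\mathbb{Z}^d$ defined by $\alpha^{\eta(x,w)}\theta(x)=\theta(\varphi^w x)$ is continuous. A bounded orbit equivalence from $(X,\varphi,\mathbb{Z}^d)$ to $(Y,\psi,\mathbb{Z}^d)$ is a homeomorphism $\theta:X\to Y$ that maps orbits onto orbits and for which the function $\eta:X\times\mathbb{Z}^d\to\mathbb{Z}^d$ with $\theta(\varphi^v x)=\psi^{\eta(x,v)}\theta(x)$ is continuous; in particular it is a bounded orbit injection. Let $B(\varphi)$ be the subgroup of $C(X,\mathbb{Z})$ generated by the functions $1_A-1_{\varphi^vA}$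 with $A\subset X$ clopen and $v\in\mathbb{Z}^d$, and put $G(\varphi)=C(X,\mathbb{Z})/B(\varphi)$ and $G(\varphi)_+=\{[f]: f\ge 0\}$. A bounded orbit injection $\theta$ from $(X,\varphi,\mathbb{Z}^d)$ to $(Z,\alpha,\mathbb{Z}^d)$ induces a homomorphism $h_\theta:G(\varphi)\to G(\alpha)$ with $h_\theta[1_A]=[1_{\theta(A)}]$ for every clopen $A\subset X$. An isomorphism from $(G,G_+)$ to $(H,H_+)$ is a group isomorphism $h:G\to H$ with $h(G_+)=H_+$. **Theorem.** Let $(X,\varphi,\mathbb{Z}^d)$, $(Y,\psi,\mathbb{Z}^d)$ and $(Z,\alpha,\mathbb{Z}^d)$ be free minimal Cantor systems, and let $\theta_1:X\to Z$ and $\theta_2:Y\to Z$ be bounded orbit injections from the first and from the second system into the third. Suppose that $h_{\theta_1}[1_X]=h_{\theta_2}[1_Y]$ in $G(\alpha)$. Then $h_{\theta_1}:(G(\varphi),G(\varphi)_+)\to(G(\alpha),G(\alpha)_+)$ and $h_{\theta_2}:(G(\psi),G(\psi)_+)\to(G(\alpha),G(\alpha)_+)$ are isomorphisms, and there is a bounded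 orbit equivalence $\theta$ from $(X,\varphi,\mathbb{Z}^d)$ to $(Y,\psi,\mathbb{Z}^d)$ such that $h_\theta=h_{\theta_2}^{-1}h_{\theta_1}$; moreover this $h_\theta$ is an isomorphism from $(G(\varphi),G(\varphi)_+)$ to $(G(\psi),G(\psi)_+)$. -/

import Mathlib

/-- A Cantor set: a topological space homeomorphic to `{0,1}^ℕ`. -/
class IsCantorSet (X : Type*) [TopologicalSpace X] : Prop where
  homeo : Nonempty (X ≃ₜ (ℕ → Bool))

instance (priority := 100) IsCantorSet.compactSpace (X : Type*) [TopologicalSpace X]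
    [h : IsCantorSet X] : CompactSpace X :=
  h.homeo.some.symm.compactSpace

instance (priority := 100) IsCantorSet.t2Space (X : Type*) [TopologicalSpace X]
    [h : IsCantorSet X] : T2Space X :=
  h.homeo.some.symm.t2Space

/-- The action of `ℤ^d = Fin d → ℤ` on the Cantor set `X` by homeomorphisms is free (no nonzero
vector fixes a point) and minimal (every orbit is dense), i.e. `X` is a free minimal Cantor
system. -/
structure IsFreeMinimalCantorSystem (d : ℕ) (X : Type*) [TopologicalSpace X] [IsCantorSet X]
    [AddAction (Fin d → ℤ) X] [ContinuousConstVAdd (Fin d → ℤ) X] : Prop where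
  free : ∀ (v : Fin d → ℤ) (x : X), v +ᵥ x = x → v = 0
  minimal : ∀ x : X, Dense (AddAction.orbit (Fin d → ℤ) x)

/-- Bounded orbit injections: continuous open injections which preserve and reflect the orbit
relation and whose cocycle `η : X × ℤ^d → ℤ^d` is continuous (for a free action on the target,
`η` is uniquely determined by the displayed identity). -/
structure IsBoundedOrbitInjection (d : ℕ) {X Z : Type*} [TopologicalSpace X] [TopologicalSpace Z]
    [AddAction (Fin d → ℤ) X] [AddAction (Fin d → ℤ) Z] (θ : X → Z) : Prop where
  continuous : Continuous θ
  isOpenMap : IsOpenMap θ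
  injective : Function.Injective θ
  orbit_iff : ∀ x y : X,
    (∃ w : Fin d → ℤ, w +ᵥ x = y) ↔ ∃ v : Fin d → ℤ, v +ᵥ θ x = θ y
  cocycle : ∃ η : X × (Fin d → ℤ) → (Fin d → ℤ), Continuous η ∧
    ∀ (x : X) (w : Fin d → ℤ), η (x, w) +ᵥ θ x = θ (w +ᵥ x)

/-- Bounded orbit equivalences: homeomorphisms mapping orbits onto orbits whose cocycle is
continuous. -/
structure IsBoundedOrbitEquivalence (d : ℕ) {X Y : Type*} [TopologicalSpace X] [TopologicalSpace Y]
    [AddAction (Fin d → ℤ) X] [AddAction (Fin d → ℤ) Y] (θ : X → Y) : Prop where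
  isHomeomorph : IsHomeomorph θ
  image_orbit : ∀ x : X,
    θ '' AddAction.orbit (Fin d → ℤ) x = AddAction.orbit (Fin d → ℤ) (θ x)
  cocycle : ∃ η : X × (Fin d → ℤ) → (Fin d → ℤ), Continuous η ∧
    ∀ (x : X) (v : Fin d → ℤ), θ (v +ᵥ x) = η (x, v) +ᵥ θ x

theorem IsBoundedOrbitEquivalence.isBoundedOrbitInjection {d : ℕ} {X Y : Type*}
    [TopologicalSpace X] [TopologicalSpace Y]
    [AddAction (Fin d → ℤ) X] [AddAction (Fin d → ℤ) Y] {θ : X → Y}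
    (h : IsBoundedOrbitEquivalence d θ) : IsBoundedOrbitInjection d θ where
  continuous := h.isHomeomorph.continuous
  isOpenMap := h.isHomeomorph.isOpenMap
  injective := h.isHomeomorph.injective
  orbit_iff x y := by
    have key : y ∈ AddAction.orbit (Fin d → ℤ) x ↔
        θ y ∈ AddAction.orbit (Fin d → ℤ) (θ x) := by
      rw [← h.image_orbit x, h.isHomeomorph.injective.mem_set_image]
    simpa [AddAction.mem_orbit_iff] using key
  cocycle := by
    obtain ⟨η, hη, hηe⟩ := h.cocycle
    exact ⟨η, hη, fun x w => (hηe x w).symm⟩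

/-- The indicator function `1_A ∈ C(X, ℤ)` of a clopen set `A`. -/
noncomputable def clopenIndicator {X : Type*} [TopologicalSpace X] (A : Set X) (hA : IsClopen A) :
    C(X, ℤ) where
  toFun := A.indicator 1
  continuous_toFun := continuous_one.indicator (by simp [hA.frontier_eq])

theorem isClopen_translate {d : ℕ} {X : Type*} [TopologicalSpace X] [AddAction (Fin d → ℤ) X]
    [ContinuousConstVAdd (Fin d → ℤ) X] {A : Set X} (hA : IsClopen A) (v : Fin d → ℤ) :
    IsClopen ((fun x : X => v +ᵥ x) '' A) :=
  ⟨(Homeomorph.vadd v : X ≃ₜ X).isClosedMap _ hA.isClosed,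
    (Homeomorph.vadd v : X ≃ₜ X).isOpenMap _ hA.isOpen⟩

/-- The group `B(φ)` of coboundaries, generated by the functions `1_A - 1_{φ^v A}` with `A` clopen
and `v ∈ ℤ^d`. -/
def coboundaries (d : ℕ) (X : Type*) [TopologicalSpace X] [AddAction (Fin d → ℤ) X]
    [ContinuousConstVAdd (Fin d → ℤ) X] : AddSubgroup C(X, ℤ) :=
  AddSubgroup.closure {f | ∃ (A : Set X) (hA : IsClopen A) (v : Fin d → ℤ),
    f = clopenIndicator A hA -
      clopenIndicator ((fun x : X => v +ᵥ x) '' A) (isClopen_translate hA v)}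

/-- The group `G(φ) = C(X, ℤ) / B(φ)`. -/
abbrev DynGroup (d : ℕ) (X : Type*) [TopologicalSpace X] [AddAction (Fin d → ℤ) X]
    [ContinuousConstVAdd (Fin d → ℤ) X] : Type _ :=
  C(X, ℤ) ⧸ coboundaries d X

/-- The class `[f] ∈ G(φ)` of `f ∈ C(X, ℤ)`. -/
def dynClass (d : ℕ) {X : Type*} [TopologicalSpace X] [AddAction (Fin d → ℤ) X]
    [ContinuousConstVAdd (Fin d → ℤ) X] (f : C(X, ℤ)) : DynGroup d X :=
  QuotientAddGroup.mk f

/-- The positive cone `G(φ)_+`. -/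
def dynPos (d : ℕ) (X : Type*) [TopologicalSpace X] [AddAction (Fin d → ℤ) X]
    [ContinuousConstVAdd (Fin d → ℤ) X] : Set (DynGroup d X) :=
  {g | ∃ f : C(X, ℤ), (∀ x, 0 ≤ f x) ∧ dynClass d f = g}

/-- An isomorphism of ordered groups `(G, G_+) → (H, H_+)`: a group isomorphism with image of
`G_+` equal to `H_+`. -/
def IsOrderedGroupIso {G H : Type*} [AddGroup G] [AddGroup H] (P : Set G) (Q : Set H)
    (h : G →+ H) : Prop :=
  Function.Bijective h ∧ h '' P = Q

/-- Transport of `f ∈ C(X, ℤ)` along `θ`, extended by zero off `θ(X)`. -/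
noncomputable def extendByZero {d : ℕ} {X Z : Type*} [TopologicalSpace X] [TopologicalSpace Z]
    [CompactSpace X] [T2Space Z] [AddAction (Fin d → ℤ) X] [AddAction (Fin d → ℤ) Z]
    (θ : X → Z) (hθ : IsBoundedOrbitInjection d θ) : C(X, ℤ) →+ C(Z, ℤ) where
  toFun f :=
    { toFun := Function.extend θ f 0
      continuous_toFun := by
        have hemb : Topology.IsOpenEmbedding θ :=
          .of_continuous_injective_isOpenMap hθ.continuous hθ.injective hθ.isOpenMap
        have hcl : IsClosed (Set.range θ) := (isCompact_range hθ.continuous).isClosed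
        rw [continuous_iff_continuousAt]
        intro z
        by_cases hz : z ∈ Set.range θ
        · obtain ⟨x, rfl⟩ := hz
          rw [← hemb.continuousAt_iff, Function.extend_comp hθ.injective]
          exact f.continuous.continuousAt
        · have hev : Function.extend θ f 0 =ᶠ[nhds z] fun _ => (0 : ℤ) := by
            filter_upwards [hcl.isOpen_compl.mem_nhds hz] with y hy
            exact Function.extend_apply' _ _ _ (by simpa using hy)
          exact continuousAt_const.congr hev.symm }
  map_zero' := by
    ext z
    by_cases hz : ∃ x, θ x = z
    · obtain ⟨x, rfl⟩ := hz
      simp [hθ.injective.extend_apply]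
    · simp [Function.extend_apply' _ _ _ hz]
  map_add' f g := by
    ext z
    by_cases hz : ∃ x, θ x = z
    · obtain ⟨x, rfl⟩ := hz
      simp [hθ.injective.extend_apply]
    · simp [Function.extend_apply' _ _ _ hz]

theorem IsBoundedOrbitInjection.isClopen_image {d : ℕ} {X Z : Type*} [TopologicalSpace X]
    [TopologicalSpace Z] [CompactSpace X] [T2Space Z] [AddAction (Fin d → ℤ) X]
    [AddAction (Fin d → ℤ) Z] {θ : X → Z} (hθ : IsBoundedOrbitInjection d θ) {A : Set X}
    (hA : IsClopen A) : IsClopen (θ '' A) :=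
  ⟨(hA.isClosed.isCompact.image hθ.continuous).isClosed, hθ.isOpenMap _ hA.isOpen⟩

theorem extendByZero_clopenIndicator {d : ℕ} {X Z : Type*} [TopologicalSpace X]
    [TopologicalSpace Z] [CompactSpace X] [T2Space Z] [AddAction (Fin d → ℤ) X]
    [AddAction (Fin d → ℤ) Z] (θ : X → Z) (hθ : IsBoundedOrbitInjection d θ) (A : Set X)
    (hA : IsClopen A) :
    extendByZero θ hθ (clopenIndicator A hA) =
      clopenIndicator (θ '' A) (hθ.isClopen_image hA) := by
  classical
  ext z
  change Function.extend θ (A.indicator 1) 0 z = (θ '' A).indicator 1 z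
  by_cases hz : ∃ x, θ x = z
  · obtain ⟨x, rfl⟩ := hz
    simp [hθ.injective.extend_apply, Set.indicator_apply, hθ.injective.eq_iff]
  · have : z ∉ θ '' A := by
      rintro ⟨x, -, rfl⟩
      exact hz ⟨x, rfl⟩
    rw [Function.extend_apply' _ _ _ hz]
    simp [this]

theorem extendByZero_coboundaries {d : ℕ} {X Z : Type*} [TopologicalSpace X]
    [TopologicalSpace Z] [CompactSpace X] [T2Space Z] [AddAction (Fin d → ℤ) X]
    [AddAction (Fin d → ℤ) Z] [ContinuousConstVAdd (Fin d → ℤ) X]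
    [ContinuousConstVAdd (Fin d → ℤ) Z] (θ : X → Z) (hθ : IsBoundedOrbitInjection d θ) :
    coboundaries d X ≤ (coboundaries d Z).comap (extendByZero θ hθ) := by
  classical
  rw [coboundaries, AddSubgroup.closure_le]
  rintro f ⟨A, hA, v, rfl⟩
  obtain ⟨η, hη, hηe⟩ := hθ.cocycle
  have hc : Continuous fun x => η (x, v) := hη.comp (by fun_prop)
  have hfin : (Set.range fun x => η (x, v)).Finite :=
    (isCompact_range hc).finite_of_discrete
  have hAh (u : Fin d → ℤ) : IsClopen (A ∩ (fun x => η (x, v)) ⁻¹' {u}) :=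
    hA.inter ((isClopen_discrete {u}).preimage hc)
  have hpt (x : X) : A.indicator (1 : X → ℤ) x =
      ∑ u ∈ hfin.toFinset, (A ∩ (fun x => η (x, v)) ⁻¹' {u}).indicator (1 : X → ℤ) x := by
    by_cases hx : x ∈ A
    · simp [Set.indicator_apply, hx]
    · simp [hx]
  have htr (B : Set X) (x : X) : ((fun x : X => v +ᵥ x) '' B).indicator (1 : X → ℤ) x =
      B.indicator (1 : X → ℤ) (-v +ᵥ x) := by
    have : x ∈ (fun x : X => v +ᵥ x) '' B ↔ -v +ᵥ x ∈ B := by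
      constructor
      · rintro ⟨y, hy, rfl⟩
        simpa using hy
      · intro h
        exact ⟨_, h, by simp⟩
    simp only [Set.indicator_apply, this]
    rfl
  have hsum : clopenIndicator A hA -
      clopenIndicator ((fun x : X => v +ᵥ x) '' A) (isClopen_translate hA v) =
      ∑ u ∈ hfin.toFinset, (clopenIndicator _ (hAh u) -
        clopenIndicator _ (isClopen_translate (hAh u) v)) := by
    ext x
    rw [ContinuousMap.sum_apply]
    simp only [ContinuousMap.sub_apply]
    change A.indicator (1 : X → ℤ) x - ((fun x : X => v +ᵥ x) '' A).indicator (1 : X → ℤ) x =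
      ∑ u ∈ hfin.toFinset, ((A ∩ (fun x => η (x, v)) ⁻¹' {u}).indicator (1 : X → ℤ) x -
        ((fun x : X => v +ᵥ x) '' (A ∩ (fun x => η (x, v)) ⁻¹' {u})).indicator (1 : X → ℤ) x)
    simp only [htr, Finset.sum_sub_distrib]
    rw [hpt x, hpt (-v +ᵥ x)]
  rw [hsum]
  change extendByZero θ hθ _ ∈ coboundaries d Z
  rw [map_sum]
  refine AddSubgroup.sum_mem _ fun u _ => ?_
  rw [map_sub, extendByZero_clopenIndicator, extendByZero_clopenIndicator]
  refine AddSubgroup.subset_closure ⟨_, hθ.isClopen_image (hAh u), u, ?_⟩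
  congr 2
  rw [Set.image_image, Set.image_image]
  refine Set.image_congr fun x hx => ?_
  have hxu : η (x, v) = u := hx.2
  rw [← hηe x v, hxu]

/-- The homomorphism `h_θ : G(φ) → G(α)` induced by a bounded orbit injection `θ`. -/
noncomputable def inducedHom {d : ℕ} {X Z : Type*} [TopologicalSpace X]
    [TopologicalSpace Z] [CompactSpace X] [T2Space Z] [AddAction (Fin d → ℤ) X]
    [AddAction (Fin d → ℤ) Z] [ContinuousConstVAdd (Fin d → ℤ) X]
    [ContinuousConstVAdd (Fin d → ℤ) Z] (θ : X → Z) (hθ : IsBoundedOrbitInjection d θ) :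
    DynGroup d X →+ DynGroup d Z :=
  QuotientAddGroup.map (coboundaries d X) (coboundaries d Z) (extendByZero θ hθ)
    (extendByZero_coboundaries θ hθ)

/-- `h_θ [1_A] = [1_{θ(A)}]` for every clopen `A`. -/
theorem inducedHom_clopenIndicator {d : ℕ} {X Z : Type*} [TopologicalSpace X]
    [TopologicalSpace Z] [CompactSpace X] [T2Space Z] [AddAction (Fin d → ℤ) X]
    [AddAction (Fin d → ℤ) Z] [ContinuousConstVAdd (Fin d → ℤ) X]
    [ContinuousConstVAdd (Fin d → ℤ) Z] (θ : X → Z) (hθ : IsBoundedOrbitInjection d θ)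
    (A : Set X) (hA : IsClopen A) :
    inducedHom θ hθ (dynClass d (clopenIndicator A hA)) =
      dynClass d (clopenIndicator (θ '' A) (hθ.isClopen_image hA)) := by
  rw [← extendByZero_clopenIndicator θ hθ A hA]
  rfl

/-! ### Locally constant maps -/

section LocallyConstant

variable {Z α β : Type*} [TopologicalSpace Z]

/-! Equality of the classes of θ₁(X) and θ₂(Y) is upgraded to geometry: for some locally constant
`n`, the map z ↦ n z +ᵥ z takes θ₁(X) bijectively onto θ₂(Y)
(`exists_bijOn_of_sub_mem_coboundaries`). Composing with θ₁ and θ₂⁻¹ gives θ. Its cocycle is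
continuous because `n` and the cocycles of θ₁ and θ₂ are, and h_{θ₂} h_θ = h_{θ₁} because θ₂(θ(C))
is a displaced copy of θ₁(C), hence has the same class.

For the upgrade, write 1_A - 1_B as a finite sum of 1_{C_i} - 1_{v_i C_i} and cut every orbit into
finite Voronoi cells around a separated clopen set of markers. Translations that stay inside a cell
cancel, so in each cell A outnumbers B by exits minus entries. Contracting a cell towards its center
shows that its boundary is a small proportion of it (`card_boundary_le`), whereas minimality makes
its visits to B a definite proportion; hence there are at most as many entries as points of B
(`exists_castle`). Reserve distinct points of B for the entries, match A with the remaining points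
of B together with the exits, and send each exit through the corresponding entry of another cell to
its reserved point. The matchings depend only on local patterns, so the displacement is locally
constant (`exists_bijOn_of_card_cell`).

That h_θ is an ordered isomorphism is softer: minimality gives a locally constant τ moving Z into
the image of θ, and pushing functions along τ and pulling them back (`transfer`) preserves
positivity and inverts extension by zero modulo coboundaries (`isOrderedGroupIso_inducedHom`). -/

theorem IsLocallyConstant.bind {f : Z → α} (hf : IsLocallyConstant f) {F : α → Z → β}
    (hF : ∀ a, IsLocallyConstant (F a)) : IsLocallyConstant fun z => F (f z) z := by
  rw [IsLocallyConstant.iff_eventually_eq]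
  intro z
  filter_upwards [hf.eventually_eq z, (hF (f z)).eventually_eq z] with y h₁ h₂
  rw [h₁, h₂]

theorem IsLocallyConstant.pair {f : Z → α} {g : Z → β} (hf : IsLocallyConstant f)
    (hg : IsLocallyConstant g) : IsLocallyConstant fun z => (f z, g z) :=
  hf.bind (F := fun a z => (a, g z)) fun a => hg.comp (Prod.mk a)

theorem IsClopen.isLocallyConstant_mem {A : Set Z} (hA : IsClopen A) :
    IsLocallyConstant fun z => z ∈ A := by
  rw [IsLocallyConstant.iff_eventually_eq]
  intro z
  by_cases hz : z ∈ A
  · filter_upwards [hA.isOpen.mem_nhds hz] with y hy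
    simp [hz, hy]
  · filter_upwards [hA.compl.isOpen.mem_nhds hz] with y hy
    simpa [hz] using hy

/-- The pattern of visits to clopen sets within a finite window is locally constant, so any choice
made as a function of such patterns is locally constant too. -/
theorem isLocallyConstant_filter (S : Finset α) {p : α → Z → Prop} [∀ a z, Decidable (p a z)]
    (hp : ∀ a, IsLocallyConstant (p a)) : IsLocallyConstant fun z => S.filter (p · z) := by
  rw [IsLocallyConstant.iff_eventually_eq]
  intro z
  have : ∀ᶠ y in nhds z, ∀ a ∈ S, p a y = p a z :=
    (Finset.eventually_all S).2 fun a _ => (hp a).eventually_eq z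
  filter_upwards [this] with y hy
  exact Finset.filter_congr fun a ha => by rw [hy a ha]

/-- Every integer valued continuous function is an integral combination of indicator functions of
clopen sets on which a given locally constant function is constant. -/
theorem mem_closure_clopenIndicator [CompactSpace Z] {F : Z → α} (hF : IsLocallyConstant F)
    (f : C(Z, ℤ)) :
    f ∈ AddSubgroup.closure {g : C(Z, ℤ) | ∃ (C : Set Z) (hC : IsClopen C),
      (∃ a, ∀ z ∈ C, F z = a) ∧ g = clopenIndicator C hC} := by
  classical
  have hH : IsLocallyConstant fun z => (F z, f z) :=
    hF.pair ((IsLocallyConstant.iff_continuous _).2 f.continuous)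
  have hf : f = ∑ p ∈ hH.range_finite.toFinset,
      p.2 • clopenIndicator _ (hH.isClopen_fiber p) := by
    ext z
    rw [ContinuousMap.sum_apply, Finset.sum_eq_single (F z, f z)]
    · simp [clopenIndicator]
    · intro p _ hp
      simp [clopenIndicator, hp.symm]
    · intro h
      exact absurd (hH.range_finite.mem_toFinset.2 ⟨z, rfl⟩) h
  rw [hf]
  refine AddSubgroup.sum_mem _ fun p _ => AddSubgroup.zsmul_mem _ (AddSubgroup.subset_closure ?_) _
  exact ⟨_, hH.isClopen_fiber p, ⟨p.1, fun z hz => congrArg Prod.fst hz⟩, rfl⟩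

end LocallyConstant

/-! ### Coboundaries -/

section Coboundaries

theorem indicator_translate {d : ℕ} {X : Type*} [AddAction (Fin d → ℤ) X] (v : Fin d → ℤ) (B : Set X) (x : X) :
    ((fun x : X => v +ᵥ x) '' B).indicator (1 : X → ℤ) x = B.indicator (1 : X → ℤ) (-v +ᵥ x) := by
  classical
  have : x ∈ (fun x : X => v +ᵥ x) '' B ↔ -v +ᵥ x ∈ B := by
    constructor
    · rintro ⟨y, hy, rfl⟩
      simpa using hy
    · intro h
      exact ⟨_, h, by simp⟩
  simp only [Set.indicator_apply, this]
  rfl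

variable {d : ℕ} {X : Type*} [TopologicalSpace X] [AddAction (Fin d → ℤ) X]
  [ContinuousConstVAdd (Fin d → ℤ) X]

theorem IsClopen.vadd_preimage {A : Set X} (hA : IsClopen A) (v : Fin d → ℤ) :
    IsClopen {x : X | v +ᵥ x ∈ A} :=
  hA.preimage (continuous_const_vadd v)

/-- An explicit finite family of sets and translations, without signs, is what can be counted cell
by cell. -/
theorem exists_sum_of_mem_coboundaries {f : C(X, ℤ)} (hf : f ∈ coboundaries d X) :
    ∃ (ι : Type) (_ : Fintype ι) (C : ι → Set X) (v : ι → Fin d → ℤ), (∀ i, IsClopen (C i)) ∧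
      ∀ x, f x = ∑ i, ((C i).indicator (1 : X → ℤ) x -
        (C i).indicator (1 : X → ℤ) (-(v i) +ᵥ x)) := by
  induction hf using AddSubgroup.closure_induction with
  | mem f hf =>
    obtain ⟨A, hA, v, rfl⟩ := hf
    refine ⟨Unit, inferInstance, fun _ => A, fun _ => v, fun _ => hA, fun x => ?_⟩
    simp [clopenIndicator, indicator_translate]
  | zero => exact ⟨Empty, inferInstance, fun _ => ∅, fun _ => 0, by simp, by simp⟩
  | add f g _ _ hf hg =>
    obtain ⟨ι, _, C, v, hC, hf⟩ := hf
    obtain ⟨κ, _, D, w, hD, hg⟩ := hg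
    refine ⟨ι ⊕ κ, inferInstance, Sum.elim C D, Sum.elim v w, ?_, fun x => ?_⟩
    · rintro (i | i)
      exacts [hC i, hD i]
    · simp only [ContinuousMap.add_apply, hf, hg, Fintype.sum_sum_type, Sum.elim_inl, Sum.elim_inr]
  | neg f _ hf =>
    obtain ⟨ι, _, C, v, hC, hf⟩ := hf
    -- The negative of 1_C - 1_{vC} is the generator for the set vC and the vector -v.
    refine ⟨ι, inferInstance, fun i => (fun x : X => v i +ᵥ x) '' C i, fun i => -v i,
      fun i => isClopen_translate (hC i) _, fun x => ?_⟩
    rw [ContinuousMap.neg_apply, hf, ← Finset.sum_neg_distrib]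
    refine Finset.sum_congr rfl fun i _ => ?_
    simp [indicator_translate]

/-- Two clopen sets which are related by a bijection with continuous displacement have the same
class. -/
theorem clopenIndicator_sub_mem_coboundaries [CompactSpace X] {A B : Set X} (hA : IsClopen A)
    (hB : IsClopen B) {n : X → Fin d → ℤ} (hn : IsLocallyConstant n)
    (h : Set.BijOn (fun x => n x +ᵥ x) A B) :
    clopenIndicator A hA - clopenIndicator B hB ∈ coboundaries d X := by
  classical
  have hAu (u : Fin d → ℤ) : IsClopen (A ∩ {x | n x = u}) := hA.inter (hn.isClopen_fiber u)
  have hsum : clopenIndicator A hA - clopenIndicator B hB =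
      ∑ u ∈ hn.range_finite.toFinset, (clopenIndicator _ (hAu u) -
        clopenIndicator _ (isClopen_translate (hAu u) u)) := by
    ext x
    rw [ContinuousMap.sum_apply]
    simp only [ContinuousMap.sub_apply, Finset.sum_sub_distrib]
    congr 1
    · change A.indicator (1 : X → ℤ) x =
        ∑ u ∈ hn.range_finite.toFinset, (A ∩ {x | n x = u}).indicator (1 : X → ℤ) x
      by_cases hx : x ∈ A
      · simp [Set.indicator_apply, hx]
      · simp [hx]
    · change B.indicator (1 : X → ℤ) x = ∑ u ∈ hn.range_finite.toFinset,
        ((fun x : X => u +ᵥ x) '' (A ∩ {x | n x = u})).indicator (1 : X → ℤ) x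
      by_cases hx : x ∈ B
      · obtain ⟨a, ha, rfl⟩ := h.surjOn hx
        rw [Finset.sum_eq_single (n a)]
        · have ha' : n a +ᵥ a ∈ (fun x : X => n a +ᵥ x) '' (A ∩ {x | n x = n a}) :=
            ⟨a, ⟨ha, rfl⟩, rfl⟩
          rw [Set.indicator_of_mem hx, Set.indicator_of_mem ha']
        · intro u _ hu
          refine Set.indicator_of_notMem ?_ _
          rintro ⟨b, ⟨hb, hbu⟩, hab⟩
          have hbu : n b = u := hbu
          have : b = a := h.injOn hb ha (by simpa [hbu] using hab)
          exact hu (by rw [← hbu, this])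
        · simp
      · rw [Set.indicator_of_notMem hx, Finset.sum_eq_zero]
        intro u _
        refine Set.indicator_of_notMem ?_ _
        rintro ⟨b, ⟨hb, hbu⟩, rfl⟩
        have hbu : n b = u := hbu
        subst hbu
        exact hx (h.mapsTo hb)
  rw [hsum]
  refine AddSubgroup.sum_mem _ fun u _ => AddSubgroup.subset_closure ?_
  exact ⟨_, hAu u, u, rfl⟩

end Coboundaries

/-! ### Cells of a Voronoi decomposition of `ℤ^d` have small boundary -/

section Folner

variable {d : ℕ}

/-- The cube of radius `r` in `ℤ^d`. -/
noncomputable def cube (d r : ℕ) : Finset (Fin d → ℤ) :=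
  Fintype.piFinset fun _ => Finset.Icc (-(r : ℤ)) r

theorem mem_cube {r : ℕ} {v : Fin d → ℤ} : v ∈ cube d r ↔ ∀ i, |v i| ≤ r := by
  simp [cube, abs_le]

theorem card_cube (d r : ℕ) : (cube d r).card = (2 * r + 1) ^ d := by
  simp only [cube, Fintype.card_piFinset, Int.card_Icc, Finset.prod_const, Finset.card_univ,
    Fintype.card_fin]
  congr 1
  omega

theorem neg_mem_cube {r : ℕ} {v : Fin d → ℤ} : -v ∈ cube d r ↔ v ∈ cube d r := by
  simp [mem_cube]

theorem exists_subset_cube (S : Finset (Fin d → ℤ)) : ∃ r : ℕ, S ⊆ cube d r := by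
  refine ⟨∑ v ∈ S, ∑ i, (v i).natAbs, fun v hv => mem_cube.2 fun i => ?_⟩
  rw [Int.abs_eq_natAbs]
  exact_mod_cast (Finset.single_le_sum (f := fun i => (v i).natAbs) (fun _ _ => Nat.zero_le _)
    (Finset.mem_univ i)).trans (Finset.single_le_sum (f := fun v => ∑ i, (v i).natAbs)
      (fun _ _ => Nat.zero_le _) hv)

theorem abs_dotProduct_le {c : ℤ} {e y : Fin d → ℤ} (he : ∀ i, |e i| ≤ c) :
    |e ⬝ᵥ y| ≤ c * ∑ i, |y i| := by
  rw [dotProduct, Finset.mul_sum]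
  refine (Finset.abs_sum_le_sum_abs _ _).trans (Finset.sum_le_sum fun i _ => ?_)
  rw [abs_mul]
  exact mul_le_mul_of_nonneg_right (he i) (abs_nonneg _)

/-- A vector outside of the cube of radius `r` has `ℓ¹`-norm much smaller than its square. -/
theorem sum_abs_mul_le_of_notMem_cube {r : ℕ} {y : Fin d → ℤ} (hy : y ∉ cube d r) :
    (∑ i, |y i|) * r ≤ d * (y ⬝ᵥ y) := by
  simp only [mem_cube, not_forall, not_le] at hy
  obtain ⟨i₀, hi₀⟩ := hy
  obtain ⟨j, -, hj⟩ := Finset.exists_max_image Finset.univ (fun i => |y i|) ⟨i₀, Finset.mem_univ _⟩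
  have h1 : ∑ i, |y i| ≤ d * |y j| := by
    simpa using Finset.sum_le_card_nsmul Finset.univ (fun i => |y i|) (|y j|)
      (fun i hi => hj i hi)
  have h2 : |y j| * |y j| ≤ y ⬝ᵥ y := by
    rw [abs_mul_abs_self]
    exact Finset.single_le_sum (f := fun i => y i * y i) (fun i _ => mul_self_nonneg _)
      (Finset.mem_univ j)
  have h3 : (r : ℤ) ≤ |y j| := hi₀.le.trans (hj i₀ (Finset.mem_univ _))
  calc (∑ i, |y i|) * r ≤ (d * |y j|) * |y j| := by gcongr
    _ = d * (|y j| * |y j|) := by ring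
    _ ≤ d * (y ⬝ᵥ y) := by gcongr

/-- Contraction of `ℤ^d` by the factor `(2 * N - j) / (2 * N)`, rounded down. -/
def contract (N j : ℕ) (v : Fin d → ℤ) : Fin d → ℤ := fun i => ((2 * N - j) * v i) / (2 * N)

/-- Rounding down costs less than 1 in each coordinate, hence at most the ℓ¹-norm of `y` after
pairing. -/
theorem contract_dotProduct {N j : ℕ} (hN : 0 < N) (v y : Fin d → ℤ) :
    |2 * N * (contract N j v ⬝ᵥ y) - (2 * N - j) * (v ⬝ᵥ y)| ≤ 2 * N * ∑ i, |y i| := by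
  have hN' : (0 : ℤ) < 2 * N := by positivity
  have : 2 * N * (contract N j v ⬝ᵥ y) - (2 * N - j) * (v ⬝ᵥ y) =
      (fun i => 2 * N * contract N j v i - (2 * N - j) * v i) ⬝ᵥ y := by
    simp only [dotProduct, Finset.mul_sum, ← Finset.sum_sub_distrib]
    exact Finset.sum_congr rfl fun i _ => by ring
  rw [this]
  refine abs_dotProduct_le fun i => ?_
  have h1 := Int.mul_ediv_add_emod ((2 * N - j) * v i) (2 * N)
  have h2 := Int.emod_nonneg ((2 * N - j) * v i) hN'.ne'
  have h3 := Int.emod_lt_of_pos ((2 * N - j) * v i) hN'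
  rw [abs_le]
  simp only [contract]
  constructor <;> linarith

/-- For j ≤ N the contraction factor is at least 1/2, so coordinates with equal rounded images
differ by less than 2. -/
theorem abs_sub_le_of_contract_eq {N j : ℕ} (hN : 0 < N) (hj : j ≤ N) {v w : Fin d → ℤ}
    (h : contract N j v = contract N j w) : v - w ∈ cube d 1 := by
  have hN' : (0 : ℤ) < 2 * N := by positivity
  have hjN : (j : ℤ) ≤ N := by exact_mod_cast hj
  have aux (a b : ℤ) (hab : ((2 * N - j) * a) / (2 * N) = ((2 * N - j) * b) / (2 * N)) :
      a - b ≤ 1 := by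
    have h1 := Int.mul_ediv_add_emod ((2 * N - j) * a) (2 * N)
    have h2 := Int.emod_lt_of_pos ((2 * N - j) * a) hN'
    have h3 := Int.mul_ediv_add_emod ((2 * N - j) * b) (2 * N)
    have h4 := Int.emod_nonneg ((2 * N - j) * b) hN'.ne'
    rw [hab] at h1
    by_contra! hlt
    have h5 : (2 * N - j : ℤ) * (a - b) < 2 * N := by linarith
    have h6 : (2 : ℤ) ≤ a - b := by linarith
    nlinarith
  refine mem_cube.2 fun i => abs_le.2 ⟨?_, ?_⟩
  · have := aux _ _ (congrFun h i).symm
    simp only [Pi.sub_apply]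
    push_cast
    linarith
  · have := aux _ _ (congrFun h i)
    simpa using this

/-- All error terms in the boundary estimate are multiples of the ℓ¹-norm of `y`; for centers far
enough apart the squared length absorbs them. -/
theorem sum_abs_mul_lt_of_notMem_cube {r c : ℕ} (hr : d * c < r) {y : Fin d → ℤ}
    (hy : y ∉ cube d r) : (∑ i, |y i|) * c < y ⬝ᵥ y := by
  have h := sum_abs_mul_le_of_notMem_cube hy
  simp only [mem_cube, not_forall, not_le] at hy
  obtain ⟨i, hi⟩ := hy
  have hd : (0 : ℤ) < d := by exact_mod_cast i.pos
  have hs : 0 < ∑ i, |y i| := lt_of_lt_of_le ((Int.natCast_nonneg r).trans_lt hi)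
    (Finset.single_le_sum (f := fun i => |y i|) (fun i _ => abs_nonneg _) (Finset.mem_univ i))
  have hr' : (d * c : ℤ) < r := by exact_mod_cast hr
  have : (∑ i, |y i|) * (d * c) < (∑ i, |y i|) * r := mul_lt_mul_of_pos_left hr' hs
  refine lt_of_mul_lt_mul_left (a := (d : ℤ)) ?_ hd.le
  linarith

open Classical in
/-- The boundary of a Voronoi cell `V` (containing the origin as its center) is small, if the
differences `y ∈ Y` to the other centers are sufficiently large. -/
theorem card_boundary_le {N r ρ : ℕ} (hN : 0 < N) (hr : d * (2 * N * (2 * ρ + 4)) < r)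
    {Y : Set (Fin d → ℤ)} (hY : ∀ y ∈ Y, y ∉ cube d r) {V : Finset (Fin d → ℤ)}
    (h₁ : ∀ v ∈ V, ∀ y ∈ Y, 2 * (v ⬝ᵥ y) ≤ y ⬝ᵥ y)
    (h₂ : ∀ v ∉ V, ∃ y ∈ Y, y ⬝ᵥ y ≤ 2 * (v ⬝ᵥ y)) :
    N * (V.filter fun v => ∃ w ∈ cube d ρ, w + v ∉ V).card ≤ 3 ^ d * V.card := by
  have hY' (y : Fin d → ℤ) (hy : y ∈ Y) :
      (∑ i, |y i|) * (2 * N * (2 * ρ + 4)) < y ⬝ᵥ y := by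
    exact_mod_cast sum_abs_mul_lt_of_notMem_cube hr (hY y hy)
  have hs (y : Fin d → ℤ) : 0 ≤ ∑ i, |y i| := Finset.sum_nonneg fun i _ => abs_nonneg _
  have hNZ : (0 : ℤ) < N := by exact_mod_cast hN
  have hρ : (0 : ℤ) ≤ ρ := Int.natCast_nonneg ρ
  -- Contracting a point of the cell puts it at depth about j/(2N) inside every bounding half-space;
  -- a boundary point stays near that depth for one of them (`hlower`).
  have hupper (j : ℕ) (hj : j ≤ N) (v : Fin d → ℤ) (hv : v ∈ V) (y : Fin d → ℤ) (hy : y ∈ Y) :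
      2 * N * (2 * (contract N j v ⬝ᵥ y)) ≤ (2 * N - j) * (y ⬝ᵥ y) + 4 * N * ∑ i, |y i| := by
    have hj' : (j : ℤ) ≤ N := by exact_mod_cast hj
    have h3 := (abs_le.1 (contract_dotProduct (j := j) hN v y)).2
    have h4 : (2 * N - j : ℤ) * (2 * (v ⬝ᵥ y)) ≤ (2 * N - j) * (y ⬝ᵥ y) :=
      mul_le_mul_of_nonneg_left (h₁ v hv y hy) (by linarith)
    linarith
  set W := V.filter fun v => ∃ w ∈ cube d ρ, w + v ∉ V with hW
  have hlower (v : Fin d → ℤ) (hv : v ∈ W) : ∃ y ∈ Y, ∀ j : ℕ, j ≤ N →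
      (2 * N - j) * (y ⬝ᵥ y) - 4 * N * ρ * ∑ i, |y i| - 4 * N * ∑ i, |y i| ≤
        2 * N * (2 * (contract N j v ⬝ᵥ y)) := by
    obtain ⟨-, w, hw, hwv⟩ := Finset.mem_filter.1 hv
    obtain ⟨y, hy, hyv⟩ := h₂ _ hwv
    refine ⟨y, hy, fun j hj => ?_⟩
    have hj' : (j : ℤ) ≤ N := by exact_mod_cast hj
    have h3 := (abs_le.1 (contract_dotProduct (j := j) hN v y)).1
    have h4 := (abs_le.1 (abs_dotProduct_le (y := y) (mem_cube.1 hw))).2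
    rw [add_dotProduct] at hyv
    have h5 : y ⬝ᵥ y - 2 * (ρ * ∑ i, |y i|) ≤ 2 * (v ⬝ᵥ y) := by linarith
    have h6 := mul_le_mul_of_nonneg_left h5 (show (0 : ℤ) ≤ 2 * N - j by linarith)
    have h7 : (0 : ℤ) ≤ j * (ρ * ∑ i, |y i|) := by have := hs y; positivity
    linarith
  -- A common image at depths j < k would force y ⬝ᵥ y to be at most 2N(2ρ + 4) times the ℓ¹-norm:
  -- 4Nρ for the width of the boundary and 4N for each of the two roundings.
  have hlt (j k : ℕ) (hk : k ≤ N) (v w : Fin d → ℤ) (hv : v ∈ W) (hw : w ∈ W)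
      (hvw : contract N j v = contract N k w) : k ≤ j := by
    by_contra! hjk
    obtain ⟨y, hy, hlow⟩ := hlower v hv
    have h3 := hlow j (hjk.le.trans hk)
    have h4 := hupper k hk w (Finset.mem_filter.1 hw).1 y hy
    rw [← hvw] at h4
    have hjk' : (j : ℤ) + 1 ≤ k := by exact_mod_cast hjk
    have hD := hY' y hy
    have hD0 : 0 ≤ y ⬝ᵥ y := le_trans (by have := hs y; positivity) hD.le
    have := mul_le_mul_of_nonneg_right hjk' hD0
    linarith
  have hmaps : ∀ p ∈ Finset.Icc 1 N ×ˢ W, contract N p.1 p.2 ∈ V := by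
    rintro ⟨j, v⟩ hp
    obtain ⟨hj, hv⟩ := Finset.mem_product.1 hp
    obtain ⟨hj1, hjN⟩ := Finset.mem_Icc.1 hj
    by_contra hnot
    obtain ⟨y, hy, hyv⟩ := h₂ _ hnot
    have h4 := hupper j hjN v (Finset.mem_filter.1 hv).1 y hy
    have hD := hY' y hy
    have hD0 : 0 ≤ y ⬝ᵥ y := le_trans (by have := hs y; positivity) hD.le
    have hj1' : (1 : ℤ) ≤ j := by exact_mod_cast hj1
    have h5 := mul_le_mul_of_nonneg_right hj1' hD0
    have h6 := mul_le_mul_of_nonneg_left hyv (show (0 : ℤ) ≤ 2 * N by positivity)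
    have h7 : (0 : ℤ) ≤ N * ρ * ∑ i, |y i| := by have := hs y; positivity
    have h8 : (0 : ℤ) ≤ N * ∑ i, |y i| := by have := hs y; positivity
    simp only at h6
    linarith
  -- By `hlt` the image determines the depth, and at a fixed depth the preimages differ by vectors
  -- of the unit cube.
  have hfib : ∀ b ∈ V, ((Finset.Icc 1 N ×ˢ W).filter
      fun p => contract N p.1 p.2 = b).card ≤ 3 ^ d := by
    intro b _
    rcases Finset.eq_empty_or_nonempty
      ((Finset.Icc 1 N ×ˢ W).filter fun p => contract N p.1 p.2 = b) with h | ⟨p₀, hp₀⟩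
    · simp [h]
    have hcube := card_cube d 1
    rw [show 2 * 1 + 1 = 3 from rfl] at hcube
    rw [← hcube]
    simp only [Finset.mem_filter, Finset.mem_product, Finset.mem_Icc] at hp₀
    have hfst (p : ℕ × (Fin d → ℤ)) (hp : p ∈ (Finset.Icc 1 N ×ˢ W).filter
        fun p => contract N p.1 p.2 = b) : p.1 = p₀.1 := by
      simp only [Finset.mem_filter, Finset.mem_product, Finset.mem_Icc] at hp
      have h := hp.2.trans hp₀.2.symm
      exact le_antisymm (hlt _ _ hp.1.1.2 _ _ hp₀.1.2 hp.1.2 h.symm)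
        (hlt _ _ hp₀.1.1.2 _ _ hp.1.2 hp₀.1.2 h)
    refine Finset.card_le_card_of_injOn (fun p => p.2 - p₀.2) (fun p hp => ?_)
      fun p hp q hq hpq => ?_
    · have h1 := hfst p hp
      simp only [Finset.coe_filter, Set.mem_ofPred_eq] at hp
      have h := hp.2.trans hp₀.2.symm
      rw [h1] at h
      exact abs_sub_le_of_contract_eq hN hp₀.1.1.2 h
    · exact Prod.ext ((hfst p hp).trans (hfst q hq).symm) (sub_left_injective hpq)
  have := Finset.card_le_mul_card_image_of_maps_to hmaps _ hfib
  rwa [Finset.card_product, Nat.card_Icc, Nat.add_sub_cancel] at this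

end Folner

/-! ### Clopen castles with small boundary -/

section Castle

variable {d : ℕ} {Z : Type*} [AddAction (Fin d → ℤ) Z]

theorem cube_mono {r s : ℕ} (h : r ≤ s) : cube d r ⊆ cube d s := fun _ hv =>
  mem_cube.2 fun i => (mem_cube.1 hv i).trans (by exact_mod_cast h)

open Classical in
/-- The cell with center `m`: those `v` in `S` for which `c` points from `v +ᵥ m` to `m`. -/
noncomputable def cell (S : Finset (Fin d → ℤ)) (c : Z → Fin d → ℤ) (m : Z) :
    Finset (Fin d → ℤ) :=
  S.filter fun v => c (v +ᵥ m) = -v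

/-- `S` contains every value of `-c`, so restricting to it loses nothing. -/
theorem mem_cell {S : Finset (Fin d → ℤ)} {c : Z → Fin d → ℤ} (hS : ∀ z, -c z ∈ S) {m : Z}
    {v : Fin d → ℤ} : v ∈ cell S c m ↔ c (v +ᵥ m) = -v := by
  simp only [cell, Finset.mem_filter, and_iff_right_iff_imp]
  intro h
  have := hS (v +ᵥ m)
  rwa [h, neg_neg] at this

variable [TopologicalSpace Z] [ContinuousConstVAdd (Fin d → ℤ) Z]

theorem isClopen_exists_cube {M : Set Z} (hM : IsClopen M) (r : ℕ) :
    IsClopen {z : Z | ∃ w ∈ cube d r, w +ᵥ z ∈ M} := by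
  have : {z : Z | ∃ w ∈ cube d r, w +ᵥ z ∈ M} = ⋃ w ∈ cube d r, {z : Z | w +ᵥ z ∈ M} := by
    ext
    simp
  rw [this]
  exact isClopen_biUnion_finset fun w _ => hM.vadd_preimage w

/-- The displacement from `z` to a nearest point of the marker set depends on `z` in a locally
constant way. -/
theorem exists_nearest {M : Set Z} (hM : IsClopen M) {r : ℕ}
    (hcov : ∀ z, ∃ w ∈ cube d r, w +ᵥ z ∈ M) :
    ∃ c : Z → Fin d → ℤ, IsLocallyConstant c ∧ (∀ z, c z +ᵥ z ∈ M) ∧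
      ∀ (z : Z) (w : Fin d → ℤ), w +ᵥ z ∈ M → c z ⬝ᵥ c z ≤ w ⬝ᵥ w := by
  classical
  have hpick (S : Finset (Fin d → ℤ)) : ∃ a, S.Nonempty → a ∈ S ∧ ∀ w ∈ S, a ⬝ᵥ a ≤ w ⬝ᵥ w := by
    by_cases hS : S.Nonempty
    · obtain ⟨a, ha, h⟩ := S.exists_min_image (fun w => w ⬝ᵥ w) hS
      exact ⟨a, fun _ => ⟨ha, h⟩⟩
    · exact ⟨0, fun h => absurd h hS⟩
  choose pick hpick using hpick
  -- Some marker lies in the cube of radius `r`, at squared distance at most d r². Vectors outside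
  -- the cube of radius `R` are longer, so a finite search finds a nearest marker.
  set R : ℕ := d * (r * r) + r with hR
  let cand : Z → Finset (Fin d → ℤ) := fun z => (cube d R).filter fun w => w +ᵥ z ∈ M
  have hcand : IsLocallyConstant cand :=
    isLocallyConstant_filter _ fun w => (hM.vadd_preimage w).isLocallyConstant_mem
  have hne (z : Z) : ∃ w ∈ cand z, w ∈ cube d r := by
    obtain ⟨w, hw, hwz⟩ := hcov z
    exact ⟨w, Finset.mem_filter.2 ⟨cube_mono (Nat.le_add_left _ _) hw, hwz⟩, hw⟩
  have hspec (z : Z) := hpick (cand z) (let ⟨w, hw, _⟩ := hne z; ⟨w, hw⟩)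
  refine ⟨fun z => pick (cand z), hcand.comp pick, fun z => (Finset.mem_filter.1 (hspec z).1).2,
    fun z w hw => ?_⟩
  by_cases hwR : w ∈ cube d R
  · exact (hspec z).2 w (Finset.mem_filter.2 ⟨hwR, hw⟩)
  obtain ⟨w₀, hw₀, hw₀r⟩ := hne z
  refine ((hspec z).2 w₀ hw₀).trans ?_
  have h1 : w₀ ⬝ᵥ w₀ ≤ d * (r * r) := by
    have : ∀ i ∈ Finset.univ, w₀ i * w₀ i ≤ (r * r : ℤ) := fun i _ => by
      rw [← abs_mul_abs_self]
      have := mem_cube.1 hw₀r i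
      gcongr
    simpa [dotProduct] using Finset.sum_le_card_nsmul Finset.univ (fun i => w₀ i * w₀ i) _ this
  simp only [mem_cube, not_forall, not_le] at hwR
  obtain ⟨i, hi⟩ := hwR
  have h2 : |w i| * |w i| ≤ w ⬝ᵥ w := by
    rw [abs_mul_abs_self]
    exact Finset.single_le_sum (f := fun i => w i * w i) (fun i _ => mul_self_nonneg _)
      (Finset.mem_univ i)
  have h3 : (d * (r * r) : ℤ) ≤ R := by
    rw [hR]
    push_cast
    linarith [Int.natCast_nonneg r]
  nlinarith [Int.natCast_nonneg R]

variable [CompactSpace Z]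

/-- In a minimal system the return times to a nonempty open set are uniformly bounded. -/
theorem exists_cube_return (hmin : ∀ z : Z, Dense (AddAction.orbit (Fin d → ℤ) z)) {B : Set Z}
    (hB : IsOpen B) (hne : B.Nonempty) : ∃ ρ : ℕ, ∀ z : Z, ∃ w ∈ cube d ρ, w +ᵥ z ∈ B := by
  obtain ⟨t, ht⟩ := isCompact_univ.elim_finite_subcover (fun w : Fin d → ℤ => {z : Z | w +ᵥ z ∈ B})
    (fun w => hB.preimage (continuous_const_vadd w)) fun z _ => by
      obtain ⟨_, hy, w, rfl⟩ := (hmin z).inter_open_nonempty B hB hne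
      exact Set.mem_iUnion.2 ⟨w, hy⟩
  obtain ⟨ρ, hρ⟩ := exists_subset_cube t
  refine ⟨ρ, fun z => ?_⟩
  obtain ⟨w, hw, hwz⟩ := Set.mem_iUnion₂.1 (ht (Set.mem_univ z))
  exact ⟨w, hρ hw, hwz⟩

/-- Freeness separates `z` from each of finitely many translates by clopen sets; intersect these. -/
theorem exists_isClopen_disjoint_translates [T2Space Z] [TotallyDisconnectedSpace Z]
    (hfree : ∀ (v : Fin d → ℤ) (z : Z), v +ᵥ z = z → v = 0) (r : ℕ) (z : Z) :
    ∃ U : Set Z, IsClopen U ∧ z ∈ U ∧ ∀ y ∈ U, ∀ w ∈ cube d r, w +ᵥ y ∈ U → w = 0 := by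
  classical
  have h (w : Fin d → ℤ) : ∃ U : Set Z, IsClopen U ∧ z ∈ U ∧ ∀ y ∈ U, w +ᵥ y ∈ U → w = 0 := by
    by_cases hw : w = 0
    · exact ⟨Set.univ, isClopen_univ, Set.mem_univ z, fun _ _ _ => hw⟩
    have hne : z ∈ ({w +ᵥ z} : Set Z)ᶜ := fun h => hw (hfree w z (Eq.symm h))
    obtain ⟨A, hA, hzA, hAw⟩ := compact_exists_isClopen_in_isOpen
      (isClosed_singleton.isOpen_compl) hne
    exact ⟨A ∩ {y | w +ᵥ y ∈ A}ᶜ, hA.inter (hA.vadd_preimage w).compl,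
      ⟨hzA, fun h => hAw h rfl⟩, fun y hy hwy => absurd hwy.1 hy.2⟩
  choose U hU hzU hUw using h
  refine ⟨⋂ w ∈ cube d r, U w, isClopen_biInter_finset fun w _ => hU w,
    Set.mem_iInter₂.2 fun w _ => hzU w, fun y hy w hw hwy => ?_⟩
  exact hUw w y (Set.mem_iInter₂.1 hy w hw) (Set.mem_iInter₂.1 hwy w hw)

/-- Existence of a maximal `r`-separated clopen set of markers. -/
theorem exists_isClopen_markers [T2Space Z] [TotallyDisconnectedSpace Z]
    (hfree : ∀ (v : Fin d → ℤ) (z : Z), v +ᵥ z = z → v = 0) (r : ℕ) :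
    ∃ M : Set Z, IsClopen M ∧ (∀ z ∈ M, ∀ w ∈ cube d r, w +ᵥ z ∈ M → w = 0) ∧
      ∀ z, ∃ w ∈ cube d r, w +ᵥ z ∈ M := by
  classical
  choose U hU hzU hUw using exists_isClopen_disjoint_translates (Z := Z) hfree r
  obtain ⟨t, ht⟩ := isCompact_univ.elim_finite_subcover U (fun z => (hU z).isOpen)
    fun z _ => Set.mem_iUnion.2 ⟨z, hzU z⟩
  have key (t : Finset Z) : ∃ M : Set Z, IsClopen M ∧
      (∀ z ∈ M, ∀ w ∈ cube d r, w +ᵥ z ∈ M → w = 0) ∧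
      ∀ a ∈ t, ∀ z ∈ U a, ∃ w ∈ cube d r, w +ᵥ z ∈ M := by
    induction t using Finset.induction_on with
    | empty => exact ⟨∅, isClopen_empty, by simp, by simp⟩
    | insert a t _ ih =>
      obtain ⟨M, hM, hsep, hcov⟩ := ih
      -- Greedy extension: add exactly those points of `U a` that have no marker within `r` yet.
      refine ⟨M ∪ (U a ∩ {z | ∃ w ∈ cube d r, w +ᵥ z ∈ M}ᶜ),
        hM.union ((hU a).inter (isClopen_exists_cube hM r).compl), ?_, ?_⟩
      · rintro z (hz | ⟨hz, hz'⟩) w hw (hwz | ⟨hwz, hwz'⟩)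
        · exact hsep z hz w hw hwz
        · exact absurd ⟨-w, neg_mem_cube.2 hw, by simpa using hz⟩ hwz'
        · exact absurd ⟨w, hw, hwz⟩ hz'
        · exact hUw a z hz w hw hwz
      · intro b hb z hz
        by_cases hex : ∃ w ∈ cube d r, w +ᵥ z ∈ M
        · obtain ⟨w, hw, hwz⟩ := hex
          exact ⟨w, hw, Or.inl hwz⟩
        rcases Finset.mem_insert.1 hb with rfl | hb
        · refine ⟨0, mem_cube.2 fun i => by simp, Or.inr ?_⟩
          rw [zero_vadd]
          exact ⟨hz, hex⟩
        · exact absurd (hcov b hb z hz) hex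
  obtain ⟨M, hM, hsep, hcov⟩ := key t
  refine ⟨M, hM, hsep, fun z => ?_⟩
  obtain ⟨a, ha, hza⟩ := Set.mem_iUnion₂.1 (ht (Set.mem_univ z))
  exact hcov a ha z hza

open Classical in
/-- There are clopen castles whose towers have a boundary which is arbitrarily small compared to
the number of visits of the tower to a given nonempty clopen set. -/
theorem exists_castle [T2Space Z] [TotallyDisconnectedSpace Z]
    (hfree : ∀ (v : Fin d → ℤ) (z : Z), v +ᵥ z = z → v = 0)
    (hmin : ∀ z : Z, Dense (AddAction.orbit (Fin d → ℤ) z)) {B : Set Z}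
    (hB : IsOpen B) (hne : B.Nonempty) (k ρ : ℕ) :
    ∃ (c : Z → Fin d → ℤ) (S : Finset (Fin d → ℤ)), IsLocallyConstant c ∧ (∀ z, -c z ∈ S) ∧
      ∀ m, k * ((cell S c m).filter fun v => ∃ w ∈ cube d ρ, w + v ∉ cell S c m).card ≤
        ((cell S c m).filter fun v => v +ᵥ m ∈ B).card := by
  obtain ⟨ρ₁, hρ₁⟩ := exists_cube_return hmin hB hne
  set ρ' := max ρ ρ₁ with hρ'
  set b := (2 * ρ' + 1) ^ d with hb
  -- The factor 3^d cancels the one in `card_boundary_le`. This leaves (1 + kb)|W| ≤ |T|, that is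
  -- kb|W| ≤ |T \ W|, and `hint` bounds the right side by b times the number of visits to `B`.
  set N := 3 ^ d * (1 + k * b) with hN
  set r := d * (2 * N * (2 * ρ' + 4)) + 1 with hr
  obtain ⟨M, hM, hsep, hcov⟩ := exists_isClopen_markers (Z := Z) hfree r
  obtain ⟨c, hc, hcM, hcmin⟩ := exists_nearest hM hcov
  have hS (z : Z) : -c z ∈ hc.range_finite.toFinset.image fun v => -v :=
    Finset.mem_image_of_mem _ (hc.range_finite.mem_toFinset.2 ⟨z, rfl⟩)
  refine ⟨c, _, hc, hS, fun m => ?_⟩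
  set T := cell (hc.range_finite.toFinset.image fun v => -v) c m
  have hT (v : Fin d → ℤ) : v ∈ T ↔ c (v +ᵥ m) = -v := mem_cell hS
  by_cases hm : m ∈ M
  swap
  -- Since `c` points to markers only, any other point has an empty cell.
  · have : T = ∅ := Finset.eq_empty_of_forall_notMem fun v hv => hm <| by
      have := hcM (v +ᵥ m)
      rwa [(hT v).1 hv, neg_vadd_vadd] at this
    simp [this]
  have hNpos : 0 < N := by positivity
  have hexp (v y : Fin d → ℤ) : (y - v) ⬝ᵥ (y - v) = y ⬝ᵥ y - 2 * (v ⬝ᵥ y) + v ⬝ᵥ v := by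
    rw [sub_dotProduct, dotProduct_sub, dotProduct_sub, dotProduct_comm y v]
    ring
  have hbd := card_boundary_le (d := d) (r := r) (ρ := ρ') hNpos (by omega)
    (Y := {y | y ≠ 0 ∧ y +ᵥ m ∈ M}) (fun y hy hyr => hy.1 (hsep m hm y hyr hy.2)) (V := T)
    (fun v hv y hy => by
      have h := hcmin (v +ᵥ m) (y - v) (by rw [vadd_vadd, sub_add_cancel]; exact hy.2)
      rw [(hT v).1 hv, hexp, neg_dotProduct_neg] at h
      linarith)
    (fun v hv => by
      -- The witness is the chosen nearest marker, relative to `m`. Ties only give weak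
      -- inequalities, which suffice in both directions.
      refine ⟨c (v +ᵥ m) + v, ⟨fun h => hv ((hT v).2 (eq_neg_of_add_eq_zero_left h)), ?_⟩, ?_⟩
      · rw [← vadd_vadd]
        exact hcM _
      · have h := hcmin (v +ᵥ m) (-v) (by rwa [neg_vadd_vadd])
        rw [neg_dotProduct_neg] at h
        have h' := hexp v (c (v +ᵥ m) + v)
        rw [add_sub_cancel_right] at h'
        linarith)
  set W := T.filter fun v => ∃ w ∈ cube d ρ', w + v ∉ T with hW
  have hmono : (T.filter fun v => ∃ w ∈ cube d ρ, w + v ∉ T).card ≤ W.card :=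
    Finset.card_le_card fun v hv => by
      obtain ⟨hv, w, hw, hwv⟩ := Finset.mem_filter.1 hv
      exact Finset.mem_filter.2 ⟨hv, w, cube_mono (le_max_left _ _) hw, hwv⟩
  choose ret hret hretB using hρ₁
  have hret' (z : Z) : ret z ∈ cube d ρ' := cube_mono (le_max_right _ _) (hret z)
  -- An interior point reaches `B` by a short vector without leaving the cell, and at most `b`
  -- points reach the same visit.
  have hint : (T \ W).card ≤ b * (T.filter fun v => v +ᵥ m ∈ B).card := by
    refine Finset.card_le_mul_card_image_of_maps_to (f := fun v => ret (v +ᵥ m) + v)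
      (fun v hv => ?_) _ fun u _ => ?_
    · obtain ⟨hvT, hvW⟩ := Finset.mem_sdiff.1 hv
      refine Finset.mem_filter.2 ⟨?_, ?_⟩
      · by_contra h
        exact hvW (Finset.mem_filter.2 ⟨hvT, _, hret' _, h⟩)
      · rw [← vadd_vadd]
        exact hretB _
    · rw [hb, ← card_cube d ρ']
      refine Finset.card_le_card_of_injOn (fun v => u - v) (fun v hv => ?_)
        fun v _ w _ h => sub_right_injective h
      have : ret (v +ᵥ m) + v = u := (Finset.mem_filter.1 hv).2
      have : u - v = ret (v +ᵥ m) := by rw [← this, add_sub_cancel_right]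
      simp only [this]
      exact hret' _
  have hsplit : (T \ W).card + W.card = T.card :=
    Finset.card_sdiff_add_card_eq_card (Finset.filter_subset _ _)
  have hbd' : (1 + k * b) * W.card ≤ T.card := by
    refine Nat.le_of_mul_le_mul_left (c := 3 ^ d) ?_ (by positivity)
    rwa [← mul_assoc]
  refine (Nat.mul_le_mul_left k hmono).trans (Nat.le_of_mul_le_mul_left (c := b) ?_ (by positivity))
  linarith

end Castle

/-! ### Clopen sets with the same class are related by a bijection with continuous displacement -/

section Exchange

theorem Finset.exists_injOn_mapsTo {α β : Type*} [Nonempty β] (s : Finset α) (t : Finset β)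
    (h : s.card ≤ t.card) : ∃ f : α → β, Set.MapsTo f s t ∧ Set.InjOn f s := by
  obtain ⟨f, hf, hinj⟩ := s.finite_toSet.exists_injOn_of_encard_le (t := (t : Set β))
    (by simpa using h)
  exact ⟨f, fun x hx => hf hx, hinj⟩

/-- The matching inside one cell: `a` and `b` are the positions of A and B, `p` the exits, `q` the
entries. `f` reserves places in `b` for the entries; `t` distributes `a` over the free places and
the exits. -/
theorem Finset.exists_exchange {α β : Type*} [Nonempty α] [DecidableEq α] (a b : Finset α) (p q : Finset β)
    (h₁ : a.card + q.card = b.card + p.card) (h₂ : q.card ≤ b.card) :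
    ∃ (f : β → α) (t : α → α ⊕ β), Set.MapsTo f q b ∧ Set.InjOn f q ∧
      Set.BijOn t a ((b \ q.image f).disjSum p) := by
  obtain ⟨f, hf, hinj⟩ := Finset.exists_injOn_mapsTo q b h₂
  have hsub : q.image f ⊆ b := Finset.image_subset_iff.2 hf
  have hcard : ((b \ q.image f).disjSum p).card = a.card := by
    rw [Finset.card_disjSum, Finset.card_sdiff_of_subset hsub, Finset.card_image_of_injOn hinj]
    omega
  obtain ⟨t, ht⟩ := a.finite_toSet.exists_bijOn_of_encard_eq
    (t := (((b \ q.image f).disjSum p : Finset (α ⊕ β)) : Set (α ⊕ β))) (by simp [-card_disjSum, hcard])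
  exact ⟨f, t, hf, hinj, ht⟩

variable {d : ℕ} {Z : Type*} [TopologicalSpace Z] [AddAction (Fin d → ℤ) Z]
  [ContinuousConstVAdd (Fin d → ℤ) Z]

open Classical in
/-- A cellwise count of `A`, `B` and the exits `P i`, entries `Q i` of the cells yields a bijection
from `A` to `B` with continuous displacement. -/
theorem exists_bijOn_of_card_cell {S : Finset (Fin d → ℤ)} {c : Z → Fin d → ℤ}
    (hc : IsLocallyConstant c) (hS : ∀ z, -c z ∈ S) {ι : Type} [Fintype ι] {A B : Set Z}
    {P Q : ι → Set Z} (hA : IsClopen A) (hB : IsClopen B) (hP : ∀ i, IsClopen (P i))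
    (hQ : ∀ i, IsClopen (Q i)) (v : ι → Fin d → ℤ) (hPQ : ∀ i z, v i +ᵥ z ∈ Q i ↔ z ∈ P i)
    (h₁ : ∀ m, ((cell S c m).filter fun x => x +ᵥ m ∈ A).card +
        ((Finset.univ ×ˢ cell S c m).filter fun p => p.2 +ᵥ m ∈ Q p.1).card =
      ((cell S c m).filter fun x => x +ᵥ m ∈ B).card +
        ((Finset.univ ×ˢ cell S c m).filter fun p => p.2 +ᵥ m ∈ P p.1).card)
    (h₂ : ∀ m, ((Finset.univ ×ˢ cell S c m).filter fun p => p.2 +ᵥ m ∈ Q p.1).card ≤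
      ((cell S c m).filter fun x => x +ᵥ m ∈ B).card) :
    ∃ n : Z → Fin d → ℤ, IsLocallyConstant n ∧ Set.BijOn (fun z => n z +ᵥ z) A B := by
  have hcell : IsLocallyConstant (cell S c) := by
    unfold cell
    refine isLocallyConstant_filter (p := fun x (z : Z) => c (x +ᵥ z) = -x) S fun x => ?_
    exact (hc.comp_continuous (continuous_const_vadd x)).comp fun y => y = -x
  have hlev {W : Set Z} (hW : IsClopen W) :
      IsLocallyConstant fun m => (cell S c m).filter fun x => x +ᵥ m ∈ W :=
    hcell.bind fun T => isLocallyConstant_filter (p := fun x (z : Z) => x +ᵥ z ∈ W) T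
      fun x => (hW.vadd_preimage x).isLocallyConstant_mem
  have hlevι {W : ι → Set Z} (hW : ∀ i, IsClopen (W i)) : IsLocallyConstant fun m =>
      ((Finset.univ : Finset ι) ×ˢ cell S c m).filter fun p => p.2 +ᵥ m ∈ W p.1 :=
    hcell.bind fun T => isLocallyConstant_filter (p := fun p (z : Z) => p.2 +ᵥ z ∈ W p.1)
      ((Finset.univ : Finset ι) ×ˢ T) fun p => ((hW p.1).vadd_preimage p.2).isLocallyConstant_mem
  -- the pattern of the cell with center `m`, and the matchings which only depend on it
  let D : Z → (Finset (Fin d → ℤ) × Finset (Fin d → ℤ)) ×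
      (Finset (ι × (Fin d → ℤ)) × Finset (ι × (Fin d → ℤ))) := fun m =>
    (((cell S c m).filter fun x => x +ᵥ m ∈ A, (cell S c m).filter fun x => x +ᵥ m ∈ B),
      (((Finset.univ : Finset ι) ×ˢ cell S c m).filter fun p => p.2 +ᵥ m ∈ P p.1,
        ((Finset.univ : Finset ι) ×ˢ cell S c m).filter fun p => p.2 +ᵥ m ∈ Q p.1))
  have hD : IsLocallyConstant D := ((hlev hA).pair (hlev hB)).pair ((hlevι hP).pair (hlevι hQ))
  have hex : ∀ e : (Finset (Fin d → ℤ) × Finset (Fin d → ℤ)) ×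
      (Finset (ι × (Fin d → ℤ)) × Finset (ι × (Fin d → ℤ))),
      ∃ (f : ι × (Fin d → ℤ) → Fin d → ℤ)
        (t : (Fin d → ℤ) → (Fin d → ℤ) ⊕ (ι × (Fin d → ℤ))),
        e.1.1.card + e.2.2.card = e.1.2.card + e.2.1.card → e.2.2.card ≤ e.1.2.card →
        Set.MapsTo f e.2.2 e.1.2 ∧ Set.InjOn f e.2.2 ∧
          Set.BijOn t e.1.1 ((e.1.2 \ e.2.2.image f).disjSum e.2.1) := by
    intro e
    by_cases h : e.1.1.card + e.2.2.card = e.1.2.card + e.2.1.card ∧ e.2.2.card ≤ e.1.2.card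
    · obtain ⟨f, t, hft⟩ := Finset.exists_exchange e.1.1 e.1.2 e.2.1 e.2.2 h.1 h.2
      exact ⟨f, t, fun _ _ => hft⟩
    -- Junk values for patterns that violate the counts, so that `f` and `t` are defined on all
    -- patterns.
    · exact ⟨fun _ => 0, Sum.inl, fun h₁ h₂ => absurd ⟨h₁, h₂⟩ h⟩
  choose f t hft using hex
  have hfB (m : Z) := (hft (D m) (h₁ m) (h₂ m)).1
  have hfinj (m : Z) := (hft (D m) (h₁ m) (h₂ m)).2.1
  have ht (m : Z) := (hft (D m) (h₁ m) (h₂ m)).2.2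
  have memA {m : Z} {x : Fin d → ℤ} : x ∈ (D m).1.1 ↔ c (x +ᵥ m) = -x ∧ x +ᵥ m ∈ A := by
    simp [D, mem_cell hS]
  have memB {m : Z} {x : Fin d → ℤ} : x ∈ (D m).1.2 ↔ c (x +ᵥ m) = -x ∧ x +ᵥ m ∈ B := by
    simp [D, mem_cell hS]
  have memP {m : Z} {i : ι} {x : Fin d → ℤ} :
      (i, x) ∈ (D m).2.1 ↔ c (x +ᵥ m) = -x ∧ x +ᵥ m ∈ P i := by
    simp [D, mem_cell hS]
  have memQ {m : Z} {i : ι} {x : Fin d → ℤ} :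
      (i, x) ∈ (D m).2.2 ↔ c (x +ᵥ m) = -x ∧ x +ᵥ m ∈ Q i := by
    simp [D, mem_cell hS]
  let ctr : Z → Z := fun z => c z +ᵥ z
  have hctr (z : Z) : -c z +ᵥ ctr z = z := neg_vadd_vadd _ _
  have hcc (z : Z) : c (-c z +ᵥ ctr z) = -(-c z) := by rw [hctr, neg_neg]
  have ctr_eq {m : Z} {x : Fin d → ℤ} (h : c (x +ᵥ m) = -x) : ctr (x +ᵥ m) = m := by
    simp only [ctr, h, neg_vadd_vadd]
  -- points are determined by their cell and their position in it
  have cancel {m m' : Z} {x x' : Fin d → ℤ} (h : c (x +ᵥ m) = -x) (h' : c (x' +ᵥ m') = -x')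
      (he : x +ᵥ m = x' +ᵥ m') : m = m' ∧ x = x' :=
    ⟨by rw [← ctr_eq h, he, ctr_eq h'], neg_injective (by rw [← h, he, h'])⟩
  -- The place in B reserved for the entry `z` of type `i` by the cell containing `z`.
  let qq : ι → Z → Z := fun i z => f (D (ctr z)) (i, -c z) +ᵥ ctr z
  have hqB {i : ι} {z : Z} (hz : z ∈ Q i) : f (D (ctr z)) (i, -c z) ∈ (D (ctr z)).1.2 :=
    hfB (ctr z) (memQ.2 ⟨hcc z, by rwa [hctr]⟩)
  have hqinj {i j : ι} {z w : Z} (hz : z ∈ Q i) (hw : w ∈ Q j) (h : qq i z = qq j w) :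
      i = j ∧ z = w := by
    obtain ⟨hm, hx⟩ := cancel (memB.1 (hqB hz)).1 (memB.1 (hqB hw)).1 h
    rw [← hm] at hx
    have := hfinj (ctr z) (memQ.2 ⟨hcc z, by rwa [hctr]⟩)
      (memQ.2 ⟨by rw [hm, hcc], by rwa [hm, hctr]⟩) hx
    rw [Prod.mk.injEq] at this
    exact ⟨this.1, by rw [← hctr z, ← hctr w, this.2, hm]⟩
  let tt : Z → (Fin d → ℤ) ⊕ (ι × (Fin d → ℤ)) := fun z => t (D (ctr z)) (-c z)
  have htt {z : Z} (hz : z ∈ A) : tt z ∈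
      ((D (ctr z)).1.2 \ (D (ctr z)).2.2.image (f (D (ctr z)))).disjSum (D (ctr z)).2.1 :=
    (ht (ctr z)).mapsTo (memA.2 ⟨hcc z, by rwa [hctr]⟩)
  have httinj {z w : Z} (hz : z ∈ A) (hw : w ∈ A) (hm : ctr z = ctr w) (h : tt z = tt w) :
      z = w := by
    simp only [tt, ← hm] at h
    have := (ht (ctr z)).injOn (memA.2 ⟨hcc z, by rwa [hctr]⟩)
      (memA.2 ⟨by rw [hm, hcc], by rwa [hm, hctr]⟩) h
    rw [← hctr z, ← hctr w, this, hm]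
  -- Either go directly to a free place of B in the same cell, or go to the exit, cross by `v i`,
  -- and continue to the place reserved there.
  let n : Z → Fin d → ℤ := fun z => match tt z with
    | .inl x => x + c z
    | .inr (i, u) =>
      f (D (ctr ((v i + u + c z) +ᵥ z))) (i, -c ((v i + u + c z) +ᵥ z)) +
        c ((v i + u + c z) +ᵥ z) + (v i + u + c z)
  have hn_inl {z : Z} {x : Fin d → ℤ} (h : tt z = .inl x) : n z +ᵥ z = x +ᵥ ctr z := by
    simp only [n, h, ctr, vadd_vadd]
  have hn_inr {z : Z} {i : ι} {u : Fin d → ℤ} (h : tt z = .inr (i, u)) :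
      n z +ᵥ z = qq i (v i +ᵥ (u +ᵥ ctr z)) := by
    simp only [n, h, qq, ctr, vadd_vadd, add_assoc]
  have hDctr : IsLocallyConstant fun z => D (ctr z) :=
    hc.bind fun w => hD.comp_continuous (continuous_const_vadd w)
  have hn : IsLocallyConstant n := by
    refine (hc.pair hDctr).bind (F := fun e z => match t e.2 (-e.1) with
      | .inl x => x + e.1
      | .inr (i, u) =>
        f (D (ctr ((v i + u + e.1) +ᵥ z))) (i, -c ((v i + u + e.1) +ᵥ z)) +
          c ((v i + u + e.1) +ᵥ z) + (v i + u + e.1)) fun e => ?_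
    rcases t e.2 (-e.1) with x | ⟨i, u⟩
    · exact IsLocallyConstant.const _
    · exact ((hc.pair hDctr).comp_continuous (continuous_const_vadd (v i + u + e.1))).comp
        fun e' => f e'.2 (i, -e'.1) + e'.1 + (v i + u + e.1)
  -- the two ways in which `tt` can leave a point of `A`
  have hcases {z : Z} (hz : z ∈ A) :
      (∃ x, tt z = .inl x ∧ x ∈ (D (ctr z)).1.2 ∧
        ∀ i, ∀ w ∈ Q i, qq i w ≠ x +ᵥ ctr z) ∨
      ∃ i u, tt z = .inr (i, u) ∧ (i, u) ∈ (D (ctr z)).2.1 := by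
    have h := htt hz
    rcases hx : tt z with x | ⟨i, u⟩
    · rw [hx, Finset.inl_mem_disjSum, Finset.mem_sdiff] at h
      refine Or.inl ⟨x, rfl, h.1, fun i w hw he => h.2 ?_⟩
      obtain ⟨hm, hx'⟩ := cancel (memB.1 (hqB hw)).1 (memB.1 h.1).1 he
      rw [Finset.mem_image]
      exact ⟨(i, -c w), memQ.2 ⟨by rw [← hm, hcc], by rwa [← hm, hctr]⟩, by rw [← hm, hx']⟩
    · rw [hx, Finset.inr_mem_disjSum] at h
      exact Or.inr ⟨i, u, rfl, h⟩
  refine ⟨n, hn, fun z hz => ?_, fun z hz w hw hzw => ?_, fun y hy => ?_⟩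
  · change n z +ᵥ z ∈ B
    rcases hcases hz with ⟨x, hx, hxB, -⟩ | ⟨i, u, hu, huP⟩
    · rw [hn_inl hx]
      exact (memB.1 hxB).2
    · rw [hn_inr hu]
      exact (memB.1 (hqB ((hPQ i _).2 (memP.1 huP).2))).2
  · change n z +ᵥ z = n w +ᵥ w at hzw
    rcases hcases hz with ⟨x, hx, hxB, hxq⟩ | ⟨i, u, hu, huP⟩ <;>
      rcases hcases hw with ⟨x', hx', hxB', hxq'⟩ | ⟨i', u', hu', huP'⟩
    · rw [hn_inl hx, hn_inl hx'] at hzw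
      obtain ⟨hm, he⟩ := cancel (memB.1 hxB).1 (memB.1 hxB').1 hzw
      exact httinj hz hw hm (by rw [hx, hx', he])
    · rw [hn_inl hx, hn_inr hu'] at hzw
      exact absurd hzw.symm (hxq i' _ ((hPQ i' _).2 (memP.1 huP').2))
    · rw [hn_inr hu, hn_inl hx'] at hzw
      exact absurd hzw (hxq' i _ ((hPQ i _).2 (memP.1 huP).2))
    · rw [hn_inr hu, hn_inr hu'] at hzw
      obtain ⟨rfl, he⟩ := hqinj ((hPQ i _).2 (memP.1 huP).2) ((hPQ i' _).2 (memP.1 huP').2) hzw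
      obtain ⟨hm, he⟩ := cancel (memP.1 huP).1 (memP.1 huP').1 (vadd_left_cancel _ he)
      exact httinj hz hw hm (by rw [hu, hu', he])
  · have hlift {m : Z} {s : (Fin d → ℤ) ⊕ (ι × (Fin d → ℤ))}
        (hs : s ∈ ((D m).1.2 \ (D m).2.2.image (f (D m))).disjSum (D m).2.1) :
        ∃ z ∈ A, ctr z = m ∧ tt z = s := by
      obtain ⟨a, ha, rfl⟩ := (ht m).surjOn hs
      have ha' := memA.1 ha
      refine ⟨a +ᵥ m, ha'.2, ctr_eq ha'.1, ?_⟩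
      simp only [tt, ctr_eq ha'.1, ha'.1, neg_neg]
    have hyB : -c y ∈ (D (ctr y)).1.2 := memB.2 ⟨hcc y, by rwa [hctr]⟩
    -- A point of B reserved for an entry is traced back across `v i` to an exit and then to the
    -- point of A matched with that exit; an unreserved point is matched inside its own cell.
    by_cases hyq : -c y ∈ (D (ctr y)).2.2.image (f (D (ctr y)))
    · obtain ⟨⟨i, x⟩, hx, hfx⟩ := Finset.mem_image.1 hyq
      obtain ⟨hxc, hxQ⟩ := memQ.1 hx
      have hw : -v i +ᵥ (x +ᵥ ctr y) ∈ P i := (hPQ i _).1 (by rwa [vadd_neg_vadd])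
      set w := -v i +ᵥ (x +ᵥ ctr y) with hwdef
      obtain ⟨z, hz, hzm, hzt⟩ := hlift (m := ctr w) (s := .inr (i, -c w))
        (Finset.inr_mem_disjSum.2 (memP.2 ⟨hcc w, by rwa [hctr]⟩))
      refine ⟨z, hz, ?_⟩
      change n z +ᵥ z = y
      rw [hn_inr hzt, hzm, hctr, hwdef, vadd_neg_vadd]
      simp only [qq, ctr_eq hxc, hxc, neg_neg]
      rw [hfx, hctr]
    · obtain ⟨z, hz, hzm, hzt⟩ := hlift (m := ctr y) (s := .inl (-c y))
        (Finset.inl_mem_disjSum.2 (Finset.mem_sdiff.2 ⟨hyB, hyq⟩))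
      refine ⟨z, hz, ?_⟩
      change n z +ᵥ z = y
      rw [hn_inl hzt, hzm, hctr]

end Exchange

/-! ### Equality of classes counted cell by cell -/

section Comparison

theorem IsLocallyConstant.isClopen_setOf {Z : Type*} [TopologicalSpace Z] {p : Z → Prop}
    (hp : IsLocallyConstant p) : IsClopen {z | p z} := by
  simpa using hp.isClopen_fiber True

theorem Finset.card_filter_univ_product {ι α : Type*} [Fintype ι] (T : Finset α)
    (p : ι → α → Prop) [∀ i, DecidablePred (p i)] [DecidablePred fun q : ι × α => p q.1 q.2] :
    ((Finset.univ ×ˢ T).filter fun q => p q.1 q.2).card = ∑ i, (T.filter (p i)).card := by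
  simp only [Finset.card_filter]
  rw [Finset.sum_product]
  exact Finset.sum_congr rfl fun i _ => Finset.sum_congr rfl fun x _ => if_congr Iff.rfl rfl rfl

/-- Translations by `v` that stay inside `T` may be counted at their source or at their target. -/
theorem Finset.card_filter_add_mem_comm {G : Type*} [AddCommGroup G] [DecidableEq G]
    (T : Finset G) (v : G) (p : G → Prop) [DecidablePred p] :
    (T.filter fun x => p x ∧ v + x ∈ T).card = (T.filter fun x => p (-v + x) ∧ -v + x ∈ T).card := by
  refine Finset.card_nbij' (fun x => v + x) (fun x => -v + x) ?_ ?_ ?_ ?_ <;> intro x <;> simp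
  all_goals tauto

/-- In a free minimal Cantor system, clopen sets with the same class are related by a bijection
with continuous displacement. -/
theorem exists_bijOn_of_sub_mem_coboundaries {d : ℕ} {Z : Type*} [TopologicalSpace Z]
    [CompactSpace Z] [T2Space Z] [TotallyDisconnectedSpace Z] [AddAction (Fin d → ℤ) Z]
    [ContinuousConstVAdd (Fin d → ℤ) Z]
    (hfree : ∀ (v : Fin d → ℤ) (z : Z), v +ᵥ z = z → v = 0)
    (hmin : ∀ z : Z, Dense (AddAction.orbit (Fin d → ℤ) z)) {A B : Set Z} (hA : IsClopen A)
    (hB : IsClopen B) (hne : B.Nonempty)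
    (h : clopenIndicator A hA - clopenIndicator B hB ∈ coboundaries d Z) :
    ∃ n : Z → Fin d → ℤ, IsLocallyConstant n ∧ Set.BijOn (fun z => n z +ᵥ z) A B := by
  classical
  obtain ⟨ι, _, C, v, hC, hsum⟩ := exists_sum_of_mem_coboundaries h
  obtain ⟨ρ, hρ⟩ := exists_subset_cube (Finset.univ.image v)
  have hvρ (i : ι) : v i ∈ cube d ρ := hρ (Finset.mem_image_of_mem _ (Finset.mem_univ i))
  obtain ⟨c, S, hc, hS, hcastle⟩ :=
    exists_castle hfree hmin hB.isOpen hne (Fintype.card ι) ρ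
  have hcv (w : Fin d → ℤ) : IsLocallyConstant fun z => c (w +ᵥ z) :=
    hc.comp_continuous (continuous_const_vadd w)
  -- `z` and `v i +ᵥ z` point to the same center when c (v i +ᵥ z) = c z - v i. Thus `P i` consists
  -- of the points of `C i` that `v i` moves to another cell, and `Q i` of their targets.
  obtain ⟨P, hPmem⟩ : ∃ P : ι → Set Z, ∀ i, P i = {z | z ∈ C i ∧ c (v i +ᵥ z) ≠ c z - v i} :=
    ⟨_, fun _ => rfl⟩
  obtain ⟨Q, hQmem⟩ : ∃ Q : ι → Set Z,
      ∀ i, Q i = {z | -v i +ᵥ z ∈ C i ∧ c z ≠ c (-v i +ᵥ z) - v i} := ⟨_, fun _ => rfl⟩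
  have hP (i : ι) : IsClopen (P i) := hPmem i ▸ (hC i).inter
    (((hc.pair (hcv (v i))).comp fun e => e.2 ≠ e.1 - v i).isClopen_setOf)
  have hQ (i : ι) : IsClopen (Q i) := hQmem i ▸ ((hC i).vadd_preimage (-v i)).inter
    (((hc.pair (hcv (-v i))).comp fun e => e.1 ≠ e.2 - v i).isClopen_setOf)
  have hPm (i : ι) (m : Z) : ((cell S c m).filter fun x => x +ᵥ m ∈ P i) =
      (cell S c m).filter fun x => x +ᵥ m ∈ C i ∧ v i + x ∉ cell S c m := by
    refine Finset.filter_congr fun x hx => ?_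
    rw [mem_cell hS] at hx ⊢
    simp only [hPmem, Set.mem_ofPred_eq, vadd_vadd, hx, ne_eq, neg_add_rev, sub_eq_add_neg]
  have hQm (i : ι) (m : Z) : ((cell S c m).filter fun x => x +ᵥ m ∈ Q i) =
      (cell S c m).filter fun x => (-v i + x) +ᵥ m ∈ C i ∧ -v i + x ∉ cell S c m := by
    refine Finset.filter_congr fun x hx => ?_
    rw [mem_cell hS] at hx ⊢
    simp only [hQmem, Set.mem_ofPred_eq, vadd_vadd, hx, ne_eq, neg_add_rev, neg_neg,
      eq_sub_iff_add_eq, eq_comm]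
  have hprod (W : ι → Set Z) (m : Z) :
      ((Finset.univ ×ˢ cell S c m).filter fun p => p.2 +ᵥ m ∈ W p.1).card =
        ∑ i, ((cell S c m).filter fun x => x +ᵥ m ∈ W i).card :=
    Finset.card_filter_univ_product _ fun i x => x +ᵥ m ∈ W i
  refine exists_bijOn_of_card_cell (P := P) (Q := Q) hc hS hA hB hP hQ v
    (fun i z => by simp [hPmem, hQmem]) (fun m => ?_) fun m => ?_
  · have hcard (W : Set Z) (w : Fin d → ℤ) :
        (((cell S c m).filter fun x => (w + x) +ᵥ m ∈ W).card : ℤ) =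
          ∑ x ∈ cell S c m, W.indicator (1 : Z → ℤ) (w +ᵥ (x +ᵥ m)) := by
      simp [Set.indicator_apply, vadd_vadd]
    have hcard₀ (W : Set Z) : (((cell S c m).filter fun x => x +ᵥ m ∈ W).card : ℤ) =
        ∑ x ∈ cell S c m, W.indicator (1 : Z → ℤ) (x +ᵥ m) := by
      simpa using hcard W 0
    -- Moves within the cell contribute equally to both counts, leaving exits minus entries.
    have hi (i : ι) : (((cell S c m).filter fun x => x +ᵥ m ∈ C i).card : ℤ) -
        ((cell S c m).filter fun x => (-v i + x) +ᵥ m ∈ C i).card =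
        ((cell S c m).filter fun x => x +ᵥ m ∈ P i).card -
          ((cell S c m).filter fun x => x +ᵥ m ∈ Q i).card := by
      rw [hPm, hQm,
        ← Finset.card_filter_add_card_filter_not (s := (cell S c m).filter fun x => x +ᵥ m ∈ C i)
          fun x => v i + x ∈ cell S c m,
        ← Finset.card_filter_add_card_filter_not
          (s := (cell S c m).filter fun x => (-v i + x) +ᵥ m ∈ C i)
          fun x => -v i + x ∈ cell S c m]
      simp only [Finset.filter_filter]
      have := Finset.card_filter_add_mem_comm (cell S c m) (v i) fun x => x +ᵥ m ∈ C i
      push_cast [this]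
      ring
    have hAB := Finset.sum_congr (s₁ := cell S c m) rfl fun x _ => hsum (x +ᵥ m)
    rw [Finset.sum_comm] at hAB
    simp only [Finset.sum_sub_distrib, ← hcard, ← hcard₀, ContinuousMap.sub_apply] at hAB
    change ∑ x ∈ cell S c m, A.indicator (1 : Z → ℤ) (x +ᵥ m) -
      ∑ x ∈ cell S c m, B.indicator (1 : Z → ℤ) (x +ᵥ m) = _ at hAB
    rw [← hcard₀, ← hcard₀, ← Finset.sum_sub_distrib, Finset.sum_congr rfl fun i _ => hi i,
      Finset.sum_sub_distrib] at hAB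
    rw [hprod Q m, hprod P m]
    zify
    linarith
  -- An entry is a boundary point, being moved out of the cell by -v i; summing over `i` gives the
  -- factor `Fintype.card ι` for which the castle was chosen.
  · refine le_trans ?_ (hcastle m)
    rw [hprod Q m, ← smul_eq_mul,
      ← Finset.card_univ, ← Finset.sum_const]
    refine Finset.sum_le_sum fun i _ => ?_
    rw [hQm]
    refine Finset.card_le_card (Finset.monotone_filter_right _ fun x _ hx => ?_)
    exact ⟨-v i, neg_mem_cube.2 (hvρ i), hx.2⟩

end Comparison

/-! ### Bounded orbit injections induce isomorphisms of ordered groups -/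

section InducedHom

/-- Reduces claims about all functions to indicators of sets on which the data `F` are constant;
with K = ⊥ it proves that two homomorphisms agree. -/
theorem map_mem_of_clopenIndicator {Z α H : Type*} [TopologicalSpace Z] [CompactSpace Z]
    [AddGroup H] {F : Z → α} (hF : IsLocallyConstant F) (Φ : C(Z, ℤ) →+ H) (K : AddSubgroup H)
    (h : ∀ (C : Set Z) (hC : IsClopen C), (∃ a, ∀ z ∈ C, F z = a) → Φ (clopenIndicator C hC) ∈ K)
    (f : C(Z, ℤ)) : Φ f ∈ K := by
  have : AddSubgroup.closure {g : C(Z, ℤ) | ∃ (C : Set Z) (hC : IsClopen C),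
      (∃ a, ∀ z ∈ C, F z = a) ∧ g = clopenIndicator C hC} ≤ K.comap Φ := by
    rw [AddSubgroup.closure_le]
    rintro _ ⟨C, hC, ha, rfl⟩
    exact h C hC ha
  exact this (mem_closure_clopenIndicator hF f)

variable {d : ℕ} {X Z : Type*} [TopologicalSpace X] [TopologicalSpace Z]
  [AddAction (Fin d → ℤ) Z]

/-- Clopen sets whose images differ by a translation are related by a bijection with continuous
displacement. -/
theorem IsBoundedOrbitInjection.exists_bijOn [AddAction (Fin d → ℤ) X] {θ : X → Z} (hθ : IsBoundedOrbitInjection d θ)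
    (hX : ∀ (v : Fin d → ℤ) (x : X), v +ᵥ x = x → v = 0)
    (hZ : ∀ (v : Fin d → ℤ) (z : Z), v +ᵥ z = z → v = 0) {D E : Set X} (hD : IsClopen D)
    (w : Fin d → ℤ) (hDE : ∀ x ∈ D, ∃ y ∈ E, w +ᵥ θ x = θ y)
    (hED : ∀ y ∈ E, ∃ x ∈ D, w +ᵥ θ x = θ y) :
    ∃ n : X → Fin d → ℤ, IsLocallyConstant n ∧ Set.BijOn (fun x => n x +ᵥ x) D E := by
  classical
  obtain ⟨η, hη, hηe⟩ := hθ.cocycle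
  have hX' {u v : Fin d → ℤ} {x : X} (h : u +ᵥ x = v +ᵥ x) : u = v :=
    sub_eq_zero.1 (hX _ x (by rw [sub_eq_neg_add, ← vadd_vadd, h, neg_vadd_vadd]))
  have hZ' {u v : Fin d → ℤ} {z : Z} (h : u +ᵥ z = v +ᵥ z) : u = v :=
    sub_eq_zero.1 (hZ _ z (by rw [sub_eq_neg_add, ← vadd_vadd, h, neg_vadd_vadd]))
  have hex (x : X) : ∃ n : Fin d → ℤ, (x ∈ D → θ (n +ᵥ x) = w +ᵥ θ x) ∧ (x ∉ D → n = 0) := by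
    by_cases hx : x ∈ D
    · obtain ⟨y, -, hy⟩ := hDE x hx
      obtain ⟨n, rfl⟩ := (hθ.orbit_iff x y).2 ⟨w, hy⟩
      exact ⟨n, fun _ => hy.symm, fun h => absurd hx h⟩
    · exact ⟨0, fun h => absurd h hx, fun _ => rfl⟩
  choose n hnD hn0 using hex
  refine ⟨n, ?_, fun x hx => ?_, fun x hx y hy hxy => ?_, fun y hy => ?_⟩
  · rw [IsLocallyConstant.iff_eventually_eq]
    intro x
    by_cases hx : x ∈ D
    -- The equality η(y, n x) = w persists for y near x, and freeness then forces n y = n x.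
    · have hc : IsLocallyConstant fun y => η (y, n x) :=
        (IsLocallyConstant.iff_continuous _).2 (hη.comp (by fun_prop))
      filter_upwards [hD.isOpen.mem_nhds hx, hc.eventually_eq x] with y hy hyx
      have h1 : η (x, n x) = w := hZ' ((hηe x (n x)).trans (hnD x hx))
      refine hX' (x := y) (hθ.injective ?_)
      rw [hnD y hy, ← hηe y (n x), hyx, h1]
    · filter_upwards [hD.compl.isOpen.mem_nhds hx] with y hy
      rw [hn0 x hx, hn0 y hy]
  · obtain ⟨y, hy, hxy⟩ := hDE x hx
    have : n x +ᵥ x = y := hθ.injective ((hnD x hx).trans hxy)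
    simpa only [this] using hy
  · refine hθ.injective (vadd_left_cancel w ?_)
    rw [← hnD x hx, ← hnD y hy]
    exact congrArg θ hxy
  · obtain ⟨x, hx, hxy⟩ := hED y hy
    exact ⟨x, hx, hθ.injective ((hnD x hx).trans hxy)⟩

variable [ContinuousConstVAdd (Fin d → ℤ) Z]

/-- Return vectors come from a bounded window and are chosen from its visiting pattern. Preferring 0
makes `transfer` an exact left inverse of extension by zero. -/
theorem exists_return [CompactSpace Z]
    (hmin : ∀ z : Z, Dense (AddAction.orbit (Fin d → ℤ) z)) {U : Set Z} (hU : IsClopen U)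
    (hne : U.Nonempty) : ∃ τ : Z → Fin d → ℤ, IsLocallyConstant τ ∧ (∀ z, τ z +ᵥ z ∈ U) ∧
      ∀ z ∈ U, τ z = 0 := by
  classical
  obtain ⟨ρ, hρ⟩ := exists_cube_return hmin hU.isOpen hne
  have hpick (S : Finset (Fin d → ℤ)) : ∃ a, (S.Nonempty → a ∈ S) ∧ (0 ∈ S → a = 0) := by
    by_cases h0 : 0 ∈ S
    · exact ⟨0, fun _ => h0, fun _ => rfl⟩
    · by_cases hS : S.Nonempty
      · obtain ⟨a, ha⟩ := hS
        exact ⟨a, fun _ => ha, fun h => absurd h h0⟩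
      · exact ⟨0, fun h => absurd h hS, fun _ => rfl⟩
  choose pick hpick hpick0 using hpick
  have hcand : IsLocallyConstant fun z => (cube d ρ).filter fun w => w +ᵥ z ∈ U :=
    isLocallyConstant_filter _ fun w => (hU.vadd_preimage w).isLocallyConstant_mem
  refine ⟨fun z => pick ((cube d ρ).filter fun w => w +ᵥ z ∈ U), hcand.comp pick, fun z => ?_,
    fun z hz => hpick0 _ (Finset.mem_filter.2 ⟨mem_cube.2 fun i => by simp, by rwa [zero_vadd]⟩)⟩
  obtain ⟨w, hw, hwz⟩ := hρ z
  exact (Finset.mem_filter.1 (hpick ((cube d ρ).filter fun w => w +ᵥ z ∈ U)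
    ⟨w, Finset.mem_filter.2 ⟨hw, hwz⟩⟩)).2

/-- Pushing forward functions on `Z` along the displacement `τ` and pulling back along `θ`. -/
noncomputable def transfer [CompactSpace Z] {θ : X → Z} (hθ : Continuous θ) {τ : Z → Fin d → ℤ}
    (hτ : IsLocallyConstant τ) : C(Z, ℤ) →+ C(X, ℤ) where
  toFun g := ∑ u ∈ hτ.range_finite.toFinset,
    (g * clopenIndicator _ (hτ.isClopen_fiber u)).comp
      ⟨fun x => -u +ᵥ θ x, hθ.const_vadd (-u)⟩
  map_zero' := by
    ext x
    simp
  map_add' f g := by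
    ext x
    simp [add_mul, Finset.sum_add_distrib]

theorem transfer_apply [CompactSpace Z] {θ : X → Z} (hθ : Continuous θ) {τ : Z → Fin d → ℤ}
    (hτ : IsLocallyConstant τ) (g : C(Z, ℤ)) (x : X) :
    transfer hθ hτ g x = ∑ u ∈ hτ.range_finite.toFinset,
      g (-u +ᵥ θ x) * {z | τ z = u}.indicator (1 : Z → ℤ) (-u +ᵥ θ x) := by
  change (∑ u ∈ hτ.range_finite.toFinset,
    (g * clopenIndicator _ (hτ.isClopen_fiber u)).comp
      ⟨fun x => -u +ᵥ θ x, hθ.const_vadd (-u)⟩) x = _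
  rw [ContinuousMap.sum_apply]
  rfl

theorem transfer_clopenIndicator [CompactSpace Z] {θ : X → Z} (hθ : Continuous θ)
    {τ : Z → Fin d → ℤ} (hτ : IsLocallyConstant τ) {C : Set Z} (hC : IsClopen C) {u : Fin d → ℤ}
    (hu : ∀ z ∈ C, τ z = u) : transfer hθ hτ (clopenIndicator C hC) =
      clopenIndicator {x | -u +ᵥ θ x ∈ C} (hC.preimage (hθ.const_vadd (-u))) := by
  ext x
  rw [transfer_apply]
  change ∑ u ∈ hτ.range_finite.toFinset, C.indicator (1 : Z → ℤ) (-u +ᵥ θ x) *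
    {z | τ z = u}.indicator (1 : Z → ℤ) (-u +ᵥ θ x) =
      {x | -u +ᵥ θ x ∈ C}.indicator (1 : X → ℤ) x
  rw [Finset.sum_eq_single u]
  · by_cases hx : -u +ᵥ θ x ∈ C
    · have hx' : x ∈ {x | -u +ᵥ θ x ∈ C} := hx
      have hx'' : -u +ᵥ θ x ∈ {z | τ z = u} := hu _ hx
      rw [Set.indicator_of_mem hx, Set.indicator_of_mem hx', Set.indicator_of_mem hx'']
      rfl
    · have hx' : x ∉ {x | -u +ᵥ θ x ∈ C} := hx
      rw [Set.indicator_of_notMem hx, Set.indicator_of_notMem hx', zero_mul]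
  · intro u' _ hu'
    by_cases hx : -u' +ᵥ θ x ∈ C
    · have hx' : -u' +ᵥ θ x ∉ {z | τ z = u'} := fun h => hu' (h.symm.trans (hu _ hx))
      rw [Set.indicator_of_notMem hx', mul_zero]
    · rw [Set.indicator_of_notMem hx, zero_mul]
  · intro hnot
    have hx : -u +ᵥ θ x ∉ C := fun hx => hnot (hτ.range_finite.mem_toFinset.2 ⟨_, hu _ hx⟩)
    rw [Set.indicator_of_notMem hx, zero_mul]

variable [AddAction (Fin d → ℤ) X] [CompactSpace X] [CompactSpace Z]

/-- Cut `A` into pieces C with τ = u on C and τ = u' on vC. The transferred sets have θ-images uC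
and u'vC, which differ by u' + v - u, so orbit reflection and the continuous cocycle of θ relate
them within X. -/
theorem transfer_mem_coboundaries [ContinuousConstVAdd (Fin d → ℤ) X] {θ : X → Z} (hθ : IsBoundedOrbitInjection d θ)
    (hX : ∀ (v : Fin d → ℤ) (x : X), v +ᵥ x = x → v = 0)
    (hZ : ∀ (v : Fin d → ℤ) (z : Z), v +ᵥ z = z → v = 0)
    {τ : Z → Fin d → ℤ} (hτ : IsLocallyConstant τ) (hτU : ∀ z, τ z +ᵥ z ∈ Set.range θ) :
    coboundaries d Z ≤ (coboundaries d X).comap (transfer hθ.continuous hτ) := by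
  rw [coboundaries, AddSubgroup.closure_le]
  rintro _ ⟨A, hA, v, rfl⟩
  let T : C(Z, ℤ) →+ C(Z, ℤ) :=
    { toFun := fun g => g.comp ⟨fun z => -v +ᵥ z, continuous_const_vadd (-v)⟩
      map_zero' := rfl
      map_add' := fun _ _ => rfl }
  have hT (C : Set Z) (hC : IsClopen C) :
      T (clopenIndicator C hC) = clopenIndicator _ (isClopen_translate hC v) := by
    ext z
    exact (indicator_translate v C z).symm
  have hF : IsLocallyConstant fun z => (τ z, τ (v +ᵥ z)) :=
    hτ.pair (hτ.comp_continuous (continuous_const_vadd v))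
  have key := map_mem_of_clopenIndicator hF
    ((transfer hθ.continuous hτ).comp (AddMonoidHom.id _ - T)) (coboundaries d X) ?_
    (clopenIndicator A hA)
  · rw [← hT]
    exact key
  rintro C hC ⟨⟨u, u'⟩, hu⟩
  have hu₁ : ∀ z ∈ C, τ z = u := fun z hz => congrArg Prod.fst (hu z hz)
  have hu₂ : ∀ z ∈ (fun z : Z => v +ᵥ z) '' C, τ z = u' := by
    rintro _ ⟨z, hz, rfl⟩
    exact congrArg Prod.snd (hu z hz)
  rw [AddMonoidHom.comp_apply, AddMonoidHom.sub_apply, AddMonoidHom.id_apply, hT, map_sub,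
    transfer_clopenIndicator _ _ _ hu₁, transfer_clopenIndicator _ _ _ hu₂]
  have hDE : ∀ x ∈ {x | -u +ᵥ θ x ∈ C}, ∃ y ∈ {x | -u' +ᵥ θ x ∈ (fun z : Z => v +ᵥ z) '' C},
      (u' + v - u) +ᵥ θ x = θ y := by
    intro x hx
    have hx : -u +ᵥ θ x ∈ C := hx
    have hz : v +ᵥ (-u +ᵥ θ x) ∈ (fun z : Z => v +ᵥ z) '' C := ⟨_, hx, rfl⟩
    obtain ⟨y, hy⟩ := hτU (v +ᵥ (-u +ᵥ θ x))
    rw [hu₂ _ hz] at hy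
    refine ⟨y, ?_, ?_⟩
    · change -u' +ᵥ θ y ∈ (fun z : Z => v +ᵥ z) '' C
      rwa [hy, neg_vadd_vadd]
    · rw [hy, vadd_vadd, vadd_vadd, sub_eq_add_neg, add_assoc]
  have hED : ∀ y ∈ {x | -u' +ᵥ θ x ∈ (fun z : Z => v +ᵥ z) '' C}, ∃ x ∈ {x | -u +ᵥ θ x ∈ C},
      (u' + v - u) +ᵥ θ x = θ y := by
    rintro y ⟨z, hz, hzy⟩
    have hzy : v +ᵥ z = -u' +ᵥ θ y := hzy
    obtain ⟨x, hx⟩ := hτU z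
    rw [hu₁ z hz] at hx
    refine ⟨x, ?_, ?_⟩
    · change -u +ᵥ θ x ∈ C
      rwa [hx, neg_vadd_vadd]
    · rw [hx, vadd_vadd, sub_add_cancel, ← vadd_vadd, hzy, vadd_neg_vadd]
  obtain ⟨n, hn, hbij⟩ := hθ.exists_bijOn hX hZ (hC.preimage (hθ.continuous.const_vadd (-u))) _
    hDE hED
  exact clopenIndicator_sub_mem_coboundaries _ _ hn hbij

variable [T2Space Z]

theorem transfer_extendByZero {θ : X → Z} (hθ : IsBoundedOrbitInjection d θ)
    {τ : Z → Fin d → ℤ} (hτ : IsLocallyConstant τ) (hτ0 : ∀ z ∈ Set.range θ, τ z = 0)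
    (f : C(X, ℤ)) : transfer hθ.continuous hτ (extendByZero θ hθ f) = f := by
  ext x
  rw [transfer_apply]
  have h0 : τ (θ x) = 0 := hτ0 _ ⟨x, rfl⟩
  change ∑ u ∈ hτ.range_finite.toFinset, Function.extend θ f 0 (-u +ᵥ θ x) *
    {z | τ z = u}.indicator (1 : Z → ℤ) (-u +ᵥ θ x) = f x
  rw [Finset.sum_eq_single 0]
  · simp [hθ.injective.extend_apply, h0]
  · intro u _ hu
    by_cases hx : -u +ᵥ θ x ∈ Set.range θ
    · have hx' : -u +ᵥ θ x ∉ {z | τ z = u} := fun h => hu (h.symm.trans (hτ0 _ hx))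
      rw [Set.indicator_of_notMem hx', mul_zero]
    · rw [Function.extend_apply' _ _ _ hx, Pi.zero_apply, zero_mul]
  · intro h
    exact absurd (hτ.range_finite.mem_toFinset.2 ⟨_, h0⟩) h

/-- On a piece where τ = u the composite just translates by u, which changes the indicator by a
generator of the coboundaries. -/
theorem extendByZero_transfer_sub_mem {θ : X → Z} (hθ : IsBoundedOrbitInjection d θ)
    {τ : Z → Fin d → ℤ} (hτ : IsLocallyConstant τ) (hτU : ∀ z, τ z +ᵥ z ∈ Set.range θ)
    (g : C(Z, ℤ)) :
    extendByZero θ hθ (transfer hθ.continuous hτ g) - g ∈ coboundaries d Z := by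
  refine map_mem_of_clopenIndicator hτ
    ((extendByZero θ hθ).comp (transfer hθ.continuous hτ) - AddMonoidHom.id _) _ ?_ g
  rintro C hC ⟨u, hu⟩
  have : extendByZero θ hθ (transfer hθ.continuous hτ (clopenIndicator C hC)) =
      clopenIndicator _ (isClopen_translate hC u) := by
    rw [transfer_clopenIndicator _ _ _ hu, extendByZero_clopenIndicator]
    congr 1
    ext z
    constructor
    · rintro ⟨x, hx, rfl⟩
      exact ⟨_, hx, vadd_neg_vadd _ _⟩
    · rintro ⟨z, hz, rfl⟩
      obtain ⟨x, hx⟩ := hτU z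
      rw [hu z hz] at hx
      refine ⟨x, ?_, hx⟩
      change -u +ᵥ θ x ∈ C
      rwa [hx, neg_vadd_vadd]
  rw [AddMonoidHom.sub_apply, AddMonoidHom.comp_apply, this, AddMonoidHom.id_apply, ← neg_sub]
  exact neg_mem (AddSubgroup.subset_closure ⟨C, hC, u, rfl⟩)

/-- A bounded orbit injection into a free minimal system induces an isomorphism of ordered
groups. -/
theorem isOrderedGroupIso_inducedHom [ContinuousConstVAdd (Fin d → ℤ) X] [Nonempty X]
    {θ : X → Z} (hθ : IsBoundedOrbitInjection d θ)
    (hX : ∀ (v : Fin d → ℤ) (x : X), v +ᵥ x = x → v = 0)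
    (hZ : ∀ (v : Fin d → ℤ) (z : Z), v +ᵥ z = z → v = 0)
    (hmin : ∀ z : Z, Dense (AddAction.orbit (Fin d → ℤ) z)) :
    IsOrderedGroupIso (dynPos d X) (dynPos d Z) (inducedHom θ hθ) := by
  have hU : IsClopen (Set.range θ) := by
    rw [← Set.image_univ]
    exact hθ.isClopen_image isClopen_univ
  obtain ⟨τ, hτ, hτU, hτ0⟩ := exists_return hmin hU (Set.range_nonempty θ)
  have hsurj (g : C(Z, ℤ)) :
      inducedHom θ hθ (dynClass d (transfer hθ.continuous hτ g)) = dynClass d g :=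
    (QuotientAddGroup.eq_iff_sub_mem).2 (extendByZero_transfer_sub_mem hθ hτ hτU g)
  refine ⟨⟨?_, fun g => ?_⟩, Set.Subset.antisymm ?_ ?_⟩
  · rw [injective_iff_map_eq_zero]
    intro f
    induction f using QuotientAddGroup.induction_on with
    | H f =>
      intro hf
      rw [QuotientAddGroup.eq_zero_iff, ← transfer_extendByZero hθ hτ hτ0 f]
      exact transfer_mem_coboundaries hθ hX hZ hτ hτU ((QuotientAddGroup.eq_zero_iff _).1 hf)
  · induction g using QuotientAddGroup.induction_on with
    | H g => exact ⟨_, hsurj g⟩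
  · rintro _ ⟨_, ⟨f, hf, rfl⟩, rfl⟩
    refine ⟨extendByZero θ hθ f, fun z => ?_, rfl⟩
    change 0 ≤ Function.extend θ f 0 z
    by_cases hz : ∃ x, θ x = z
    · obtain ⟨x, rfl⟩ := hz
      rw [hθ.injective.extend_apply]
      exact hf x
    · rw [Function.extend_apply' _ _ _ hz]
      rfl
  · rintro _ ⟨g, hg, rfl⟩
    refine ⟨_, ⟨transfer hθ.continuous hτ g, fun x => ?_, rfl⟩, hsurj g⟩
    rw [transfer_apply]
    exact Finset.sum_nonneg fun u _ => mul_nonneg (hg _)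
      (Set.indicator_nonneg (fun _ _ => zero_le_one) _)

end InducedHom

/-! ### The bounded orbit equivalence -/

section OrbitEquivalence

theorem IsLocallyConstant.continuous_vadd {G Z : Type*} [TopologicalSpace Z] [VAdd G Z]
    [ContinuousConstVAdd G Z] {n : Z → G} (hn : IsLocallyConstant n) :
    Continuous fun z => n z +ᵥ z := by
  rw [continuous_iff_continuousAt]
  intro z
  refine (continuous_const_vadd (n z)).continuousAt.congr ?_
  filter_upwards [hn.eventually_eq z] with y hy
  rw [hy]

variable {d : ℕ} {X Y Z : Type*} [TopologicalSpace X] [TopologicalSpace Y] [TopologicalSpace Z]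
  [CompactSpace X] [T2Space Y]
  [AddAction (Fin d → ℤ) X] [AddAction (Fin d → ℤ) Y] [AddAction (Fin d → ℤ) Z]
  [ContinuousConstVAdd (Fin d → ℤ) X] [ContinuousConstVAdd (Fin d → ℤ) Z]

/-- If the images of two bounded orbit injections are related by a bijection with continuous
displacement, then this bijection lifts to a bounded orbit equivalence. -/
theorem exists_isBoundedOrbitEquivalence
    (hY : ∀ (v : Fin d → ℤ) (y : Y), v +ᵥ y = y → v = 0)
    (hZ : ∀ (v : Fin d → ℤ) (z : Z), v +ᵥ z = z → v = 0)
    {θ₁ : X → Z} (hθ₁ : IsBoundedOrbitInjection d θ₁)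
    {θ₂ : Y → Z} (hθ₂ : IsBoundedOrbitInjection d θ₂) {n : Z → Fin d → ℤ}
    (hn : IsLocallyConstant n)
    (hbij : Set.BijOn (fun z => n z +ᵥ z) (Set.range θ₁) (Set.range θ₂)) :
    ∃ θ : X → Y, IsBoundedOrbitEquivalence d θ ∧ ∀ x, θ₂ (θ x) = n (θ₁ x) +ᵥ θ₁ x := by
  have hY' {u v : Fin d → ℤ} {y : Y} (h : u +ᵥ y = v +ᵥ y) : u = v :=
    sub_eq_zero.1 (hY _ y (by rw [sub_eq_neg_add, ← vadd_vadd, h, neg_vadd_vadd]))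
  have hZ' {u v : Fin d → ℤ} {z : Z} (h : u +ᵥ z = v +ᵥ z) : u = v :=
    sub_eq_zero.1 (hZ _ z (by rw [sub_eq_neg_add, ← vadd_vadd, h, neg_vadd_vadd]))
  have hex (x : X) : ∃ y, θ₂ y = n (θ₁ x) +ᵥ θ₁ x := hbij.mapsTo ⟨x, rfl⟩
  choose θ hθ using hex
  have hemb : Topology.IsOpenEmbedding θ₂ :=
    .of_continuous_injective_isOpenMap hθ₂.continuous hθ₂.injective hθ₂.isOpenMap
  have hcont : Continuous θ := by
    rw [hemb.isInducing.continuous_iff]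
    have : θ₂ ∘ θ = (fun z => n z +ᵥ z) ∘ θ₁ := funext hθ
    rw [this]
    exact hn.continuous_vadd.comp hθ₁.continuous
  have hinj : Function.Injective θ := fun x x' h => by
    refine hθ₁.injective (hbij.injOn ⟨x, rfl⟩ ⟨x', rfl⟩ ?_)
    rw [← hθ, ← hθ, h]
  have hsurj : Function.Surjective θ := fun y => by
    obtain ⟨_, ⟨x, rfl⟩, hx⟩ := hbij.surjOn ⟨y, rfl⟩
    exact ⟨x, hθ₂.injective ((hθ x).trans hx)⟩
  have horbit (x x' : X) : (∃ w : Fin d → ℤ, w +ᵥ x = x') ↔ ∃ u : Fin d → ℤ, u +ᵥ θ x = θ x' := by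
    rw [hθ₁.orbit_iff, hθ₂.orbit_iff]
    constructor
    · rintro ⟨v, hv⟩
      refine ⟨n (θ₁ x') + v - n (θ₁ x), ?_⟩
      rw [hθ, hθ, ← hv, vadd_vadd, sub_add_cancel, vadd_vadd]
    · rintro ⟨v, hv⟩
      refine ⟨-n (θ₁ x') + v + n (θ₁ x), ?_⟩
      rw [add_assoc, ← vadd_vadd, ← vadd_vadd, ← hθ, hv, hθ, neg_vadd_vadd]
  have hη (x : X) (v : Fin d → ℤ) : ∃ u : Fin d → ℤ, u +ᵥ θ x = θ (v +ᵥ x) :=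
    (horbit x _).1 ⟨v, rfl⟩
  choose η hη using hη
  obtain ⟨η₁, hη₁, hη₁e⟩ := hθ₁.cocycle
  obtain ⟨η₂, hη₂, hη₂e⟩ := hθ₂.cocycle
  refine ⟨θ, ⟨isHomeomorph_iff_continuous_bijective.2 ⟨hcont, hinj, hsurj⟩, fun x => ?_,
    fun p => η p.1 p.2, ?_, fun x v => (hη x v).symm⟩, hθ⟩
  · ext y
    obtain ⟨x', rfl⟩ := hsurj y
    rw [hinj.mem_set_image, AddAction.mem_orbit_iff, AddAction.mem_orbit_iff]
    exact horbit x x'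
  · rw [continuous_prod_of_discrete_right]
    intro v
    rw [← IsLocallyConstant.iff_continuous, IsLocallyConstant.iff_eventually_eq]
    intro x
    -- With the value η x v frozen, both sides of the cocycle identity for θ become locally constant
    -- displacements of θ₁ y. They agree at x, hence nearby, and freeness of Y gives η y v = η x v.
    have h₁ : IsLocallyConstant fun y => η₂ (θ y, η x v) + n (θ₁ y) :=
      IsLocallyConstant.add ((IsLocallyConstant.iff_continuous _).2 (hη₂.comp (by fun_prop)))
        (hn.comp_continuous hθ₁.continuous)
    have h₂ : IsLocallyConstant fun y => n (θ₁ (v +ᵥ y)) + η₁ (y, v) :=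
      IsLocallyConstant.add
        (hn.comp_continuous (hθ₁.continuous.comp (continuous_const_vadd v)))
        ((IsLocallyConstant.iff_continuous _).2 (hη₁.comp (by fun_prop)))
    have e₁ (y : X) : θ₂ (η x v +ᵥ θ y) = (η₂ (θ y, η x v) + n (θ₁ y)) +ᵥ θ₁ y := by
      rw [← hη₂e, hθ, vadd_vadd]
    have e₂ (y : X) : θ₂ (θ (v +ᵥ y)) = (n (θ₁ (v +ᵥ y)) + η₁ (y, v)) +ᵥ θ₁ y := by
      rw [hθ, ← vadd_vadd, hη₁e]
    have hx : η₂ (θ x, η x v) + n (θ₁ x) = n (θ₁ (v +ᵥ x)) + η₁ (x, v) :=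
      hZ' (z := θ₁ x) (by rw [← e₁, ← e₂, hη])
    filter_upwards [h₁.eventually_eq x, h₂.eventually_eq x] with y hy₁ hy₂
    refine hY' (y := θ y) (hθ₂.injective ?_)
    rw [hη, e₁, e₂, hy₁, hy₂, hx]

end OrbitEquivalence

/-! ### Consequences of being a Cantor set, and the main theorem -/

theorem IsCantorSet.totallyDisconnectedSpace (X : Type*) [TopologicalSpace X]
    [h : IsCantorSet X] : TotallyDisconnectedSpace X :=
  h.homeo.some.symm.totallyDisconnectedSpace

theorem IsCantorSet.nonempty (X : Type*) [TopologicalSpace X] [h : IsCantorSet X] : Nonempty X :=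
  ⟨h.homeo.some.symm fun _ => false⟩

theorem one_eq_clopenIndicator_univ (X : Type*) [TopologicalSpace X] :
    (1 : C(X, ℤ)) = clopenIndicator Set.univ isClopen_univ := by
  ext x
  simp [clopenIndicator]

theorem mainTheorem5 (d : ℕ) (hd : 0 < d)
    {X Y Z : Type*} [TopologicalSpace X] [TopologicalSpace Y] [TopologicalSpace Z]
    [IsCantorSet X] [IsCantorSet Y] [IsCantorSet Z]
    [AddAction (Fin d → ℤ) X] [AddAction (Fin d → ℤ) Y] [AddAction (Fin d → ℤ) Z]
    [ContinuousConstVAdd (Fin d → ℤ) X] [ContinuousConstVAdd (Fin d → ℤ) Y]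
    [ContinuousConstVAdd (Fin d → ℤ) Z]
    (hX : IsFreeMinimalCantorSystem d X) (hY : IsFreeMinimalCantorSystem d Y)
    (hZ : IsFreeMinimalCantorSystem d Z)
    (θ₁ : X → Z) (hθ₁ : IsBoundedOrbitInjection d θ₁)
    (θ₂ : Y → Z) (hθ₂ : IsBoundedOrbitInjection d θ₂)
    (hone : inducedHom θ₁ hθ₁ (dynClass d (1 : C(X, ℤ))) =
      inducedHom θ₂ hθ₂ (dynClass d (1 : C(Y, ℤ)))) :
    ∃ (e₁ : DynGroup d X ≃+ DynGroup d Z) (e₂ : DynGroup d Y ≃+ DynGroup d Z),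
      e₁.toAddMonoidHom = inducedHom θ₁ hθ₁ ∧
      e₂.toAddMonoidHom = inducedHom θ₂ hθ₂ ∧
      IsOrderedGroupIso (dynPos d X) (dynPos d Z) (inducedHom θ₁ hθ₁) ∧
      IsOrderedGroupIso (dynPos d Y) (dynPos d Z) (inducedHom θ₂ hθ₂) ∧
      ∃ (θ : X → Y) (hθ : IsBoundedOrbitEquivalence d θ),
        inducedHom θ hθ.isBoundedOrbitInjection =
          e₂.symm.toAddMonoidHom.comp e₁.toAddMonoidHom ∧
        IsOrderedGroupIso (dynPos d X) (dynPos d Y)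
          (inducedHom θ hθ.isBoundedOrbitInjection) := by
  have := IsCantorSet.totallyDisconnectedSpace Z
  have := IsCantorSet.nonempty X
  have := IsCantorSet.nonempty Y
  have iso₁ := isOrderedGroupIso_inducedHom hθ₁ hX.free hZ.free hZ.minimal
  have iso₂ := isOrderedGroupIso_inducedHom hθ₂ hY.free hZ.free hZ.minimal
  let e₁ : DynGroup d X ≃+ DynGroup d Z := AddEquiv.ofBijective _ iso₁.1
  let e₂ : DynGroup d Y ≃+ DynGroup d Z := AddEquiv.ofBijective _ iso₂.1
  have hsub : clopenIndicator _ (hθ₁.isClopen_image isClopen_univ) -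
      clopenIndicator _ (hθ₂.isClopen_image isClopen_univ) ∈ coboundaries d Z := by
    rw [one_eq_clopenIndicator_univ, one_eq_clopenIndicator_univ, inducedHom_clopenIndicator,
      inducedHom_clopenIndicator] at hone
    exact QuotientAddGroup.eq_iff_sub_mem.1 hone
  obtain ⟨n, hn, hbij⟩ := exists_bijOn_of_sub_mem_coboundaries hZ.free hZ.minimal _ _
    (Set.univ_nonempty.image θ₂) hsub
  rw [Set.image_univ, Set.image_univ] at hbij
  obtain ⟨θ, hθ, hθn⟩ := exists_isBoundedOrbitEquivalence hY.free hZ.free hθ₁ hθ₂ hn hbij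
  have hcomp (g : DynGroup d X) :
      inducedHom θ₂ hθ₂ (inducedHom θ hθ.isBoundedOrbitInjection g) = inducedHom θ₁ hθ₁ g := by
    induction g using QuotientAddGroup.induction_on with
    | H f =>
      have key := map_mem_of_clopenIndicator (IsLocallyConstant.const ())
        (((inducedHom θ₂ hθ₂).comp (inducedHom θ hθ.isBoundedOrbitInjection) -
          inducedHom θ₁ hθ₁).comp (QuotientAddGroup.mk' (coboundaries d X))) ⊥ ?_ f
      · exact sub_eq_zero.1 (AddSubgroup.mem_bot.1 key)
      intro C hC _
      rw [AddSubgroup.mem_bot]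
      change inducedHom θ₂ hθ₂ (inducedHom θ hθ.isBoundedOrbitInjection
        (dynClass d (clopenIndicator C hC))) -
          inducedHom θ₁ hθ₁ (dynClass d (clopenIndicator C hC)) = 0
      rw [sub_eq_zero]
      rw [inducedHom_clopenIndicator, inducedHom_clopenIndicator, inducedHom_clopenIndicator]
      -- The displacement `n` that defines θ carries θ₁(C) bijectively onto θ₂(θ(C)).
      refine (QuotientAddGroup.eq_iff_sub_mem.2 ?_).symm
      refine clopenIndicator_sub_mem_coboundaries _ _ hn
        ⟨?_, hbij.injOn.mono (Set.image_subset_range _ _), ?_⟩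
      · rintro _ ⟨x, hx, rfl⟩
        exact ⟨θ x, ⟨x, hx, rfl⟩, hθn x⟩
      · rintro _ ⟨_, ⟨x, hx, rfl⟩, rfl⟩
        exact ⟨θ₁ x, ⟨x, hx, rfl⟩, (hθn x).symm⟩
  refine ⟨e₁, e₂, rfl, rfl, iso₁, iso₂, θ, hθ, ?_, ?_⟩
  · ext g
    exact (e₂.symm_apply_eq.2 (hcomp g).symm).symm
  · exact isOrderedGroupIso_inducedHom hθ.isBoundedOrbitInjection hX.free hY.free hY.minimal
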